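/- A (small) non-symmetric coloured operad $P$ (that is, a small multicategory) consists of a set of colours, a set $P(c_1,\dots,c_n;c)$ of operations for all $n\ge 0$ and all colours $c_1,\dots,c_n,c$, identity operations $1_c\in P(c;c)$, and an associative and unital composition of operations; no action of the symmetric groups is given. Let $\mathrm{Oper}_{\mathrm{ns}}$ be the category of small non-symmetric coloured operads, and let $\mathrm{rOper}_{\mathrm{ns}}$ be its full subcategory on the rigid operads, i.e. those in which every invertible unary operation is the identity of a colour. The mirror functor $M\colon \mathrm{Oper}_{\mathrm{ns}}\to\mathrm{Oper}_{\mathrm{ns}}$ sends $P$ to the operad $M(P)$ with the same colours, the operations $M(P)(c_1,\dots,c_n;c)=P(c_n,\dots,c_1;c)$, the same identities, and the composition of $P$ with the order of the composed operations reversed; on a morphism it is given by the same maps on colours and operations. It preserves rigid operads, and thus induces a functor, still denoted $M$, from $\mathrm{rOper}_{\mathrm{ns}}$ to itself. For a category $\mathcal C$, let $\mathrm{Aut}(\mathcal C)$ be the category whose objects are the autoequivalences of $\mathcal C$ and whose morphisms are all natural transformations between them; it is a monoidal category under composition of functors, with unit the identity functor. Regard the group $\mathbb Z/2\mathbb Z$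 as a discrete monoidal category whose tensor product is the group law. Theorem. For $\mathcal C=\mathrm{Oper}_{\mathrm{ns}}$ and for $\mathcal C=\mathrm{rOper}_{\mathrm{ns}}$, the monoidal category $\mathrm{Aut}(\mathcal C)$ is equivalent, as a monoidal category, to the discrete monoidal category $\mathbb Z/2\mathbb Z$. More precisely, there is a (strong) monoidal functor $\mathbb Z/2\mathbb Z\to\mathrm{Aut}(\mathcal C)$ that sends $0$ to the identity functor and $1$ to the mirror functor $M$, and that is an equivalence of categories. -/

import Mathlib

open CategoryTheory

universe u

/-- A (small) non-symmetric coloured operad, i.e. a (small) multicategory, presented by its set of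
colours and its set of all operations, each operation carrying its list of input colours and its
output colour.  The set `P(c₁, …, cₙ; c)` is recovered as `NSOperad.ops P [c₁, …, cₙ] c` below. -/
structure NSOperad : Type (u + 1) where
  /-- The set of colours. -/
  Col : Type u
  /-- The set of operations, of all arities. -/
  Op : Type u
  /-- The list `[c₁, …, cₙ]` of input colours of an operation; its length is the arity. -/
  inputs : Op → List Col
  /-- The output colour of an operation. -/
  output : Op → Col
  /-- The identity operation of a colour. -/
  one : Col → Op
  /-- The composite `p ∘ (q₁, …, qₙ)`, defined whenever the outputs of `q₁, …, qₙ` are, in this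
  order, the inputs of `p`. -/
  comp : (p : Op) → (qs : List Op) → qs.map output = inputs p → Op
  inputs_one : ∀ c, inputs (one c) = [c]
  output_one : ∀ c, output (one c) = c
  inputs_comp : ∀ p qs h, inputs (comp p qs h) = qs.flatMap inputs
  output_comp : ∀ p qs h, output (comp p qs h) = output p
  /-- `p ∘ (1, …, 1) = p`. -/
  comp_one : ∀ p (h : ((inputs p).map one).map output = inputs p),
    comp p ((inputs p).map one) h = p
  /-- `1 ∘ (p) = p`. -/
  one_comp : ∀ p (h : [p].map output = inputs (one (output p))), comp (one (output p)) [p] h = p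
  /-- Associativity, `(p ∘ (q₁, …, qₙ)) ∘ (r₁₁, …, r₁ₖ, …, rₙ₁, …, rₙₗ)
  = p ∘ (q₁ ∘ (r₁₁, …, r₁ₖ), …, qₙ ∘ (rₙ₁, …, rₙₗ))`, for a list `L` of composable families
  `(qᵢ, (rᵢ₁, …, rᵢₖ))`.  The composability conditions `h₁` and `h₂` always hold, see
  `NSOperad.composable_left` and `NSOperad.composable_right`. -/
  assoc : ∀ (p : Op) (L : List {x : Op × List Op // x.2.map output = inputs x.1})
    (h : (L.map fun x => x.1.1).map output = inputs p)
    (h₁ : (L.flatMap fun x => x.1.2).map output = inputs (comp p (L.map fun x => x.1.1) h))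
    (h₂ : (L.map fun x => comp x.1.1 x.1.2 x.2).map output = inputs p),
    comp (comp p (L.map fun x => x.1.1) h) (L.flatMap fun x => x.1.2) h₁ =
      comp p (L.map fun x => comp x.1.1 x.1.2 x.2) h₂

namespace NSOperad

theorem composable_left (P : NSOperad.{u}) (p : P.Op)
    (L : List {x : P.Op × List P.Op // x.2.map P.output = P.inputs x.1})
    (h : (L.map fun x => x.1.1).map P.output = P.inputs p) :
    (L.flatMap fun x => x.1.2).map P.output = P.inputs (P.comp p (L.map fun x => x.1.1) h) := by
  rw [P.inputs_comp, List.map_flatMap, List.flatMap_map]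
  congr 1
  funext x
  exact x.2

theorem composable_right (P : NSOperad.{u}) (p : P.Op)
    (L : List {x : P.Op × List P.Op // x.2.map P.output = P.inputs x.1})
    (h : (L.map fun x => x.1.1).map P.output = P.inputs p) :
    (L.map fun x => P.comp x.1.1 x.1.2 x.2).map P.output = P.inputs p := by
  rw [← h]
  simp [P.output_comp]

/-- The set `P(c₁, …, cₙ; c)` of operations with inputs `c₁, …, cₙ` and output `c`. -/
def ops (P : NSOperad.{u}) (cs : List P.Col) (c : P.Col) : Set P.Op :=
  {p | P.inputs p = cs ∧ P.output p = c}

/-- A morphism of non-symmetric operads: a map on colours and a map on operations compatible with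
inputs, outputs, identities and composition. -/
@[ext]
structure Hom (P Q : NSOperad.{u}) : Type u where
  /-- The map on colours. -/
  onCol : P.Col → Q.Col
  /-- The map on operations. -/
  onOp : P.Op → Q.Op
  inputs_op : ∀ p, Q.inputs (onOp p) = (P.inputs p).map onCol
  output_op : ∀ p, Q.output (onOp p) = onCol (P.output p)
  op_one : ∀ c, onOp (P.one c) = Q.one (onCol c)
  /-- Compatibility with composition; the condition `h'` always holds, see
  `NSOperad.composable_map`. -/
  op_comp : ∀ p qs (h : qs.map P.output = P.inputs p)
    (h' : (qs.map onOp).map Q.output = Q.inputs (onOp p)),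
    onOp (P.comp p qs h) = Q.comp (onOp p) (qs.map onOp) h'

theorem composable_map {P Q : NSOperad.{u}} {col : P.Col → Q.Col} {op : P.Op → Q.Op}
    (hi : ∀ p, Q.inputs (op p) = (P.inputs p).map col)
    (ho : ∀ p, Q.output (op p) = col (P.output p))
    (p : P.Op) (qs : List P.Op) (h : qs.map P.output = P.inputs p) :
    (qs.map op).map Q.output = Q.inputs (op p) := by
  rw [hi, ← h, List.map_map, List.map_map]
  congr 1
  funext q
  exact ho q

theorem comp_congr (P : NSOperad.{u}) {p p' : P.Op} {qs qs' : List P.Op} (hp : p = p')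
    (hq : qs = qs') (h : qs.map P.output = P.inputs p) (h' : qs'.map P.output = P.inputs p') :
    P.comp p qs h = P.comp p' qs' h' := by
  subst hp hq
  rfl

/-- The category of small non-symmetric coloured operads. -/
instance : LargeCategory NSOperad.{u} where
  Hom := Hom
  id P :=
    { onCol := id
      onOp := id
      inputs_op := fun p => by simp
      output_op := fun p => rfl
      op_one := fun c => rfl
      op_comp := fun p qs h h' => P.comp_congr rfl (by simp) _ _ }
  comp {P Q R} f g :=
    { onCol := g.onCol ∘ f.onCol
      onOp := g.onOp ∘ f.onOp
      inputs_op := fun p => by simp [f.inputs_op, g.inputs_op]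
      output_op := fun p => by simp [f.output_op, g.output_op]
      op_one := fun c => by simp [f.op_one, g.op_one]
      op_comp := fun p qs h h' => by
        have hf := composable_map f.inputs_op f.output_op p qs h
        have hg := composable_map g.inputs_op g.output_op _ _ hf
        rw [Function.comp_apply, f.op_comp p qs h hf, g.op_comp _ _ hf hg]
        exact R.comp_congr rfl (by simp) _ _ }
  id_comp f := rfl
  comp_id f := rfl
  assoc f g h := rfl

/-- An operation `p` is invertible if it is unary and has a two-sided inverse `q` for composition,
that is, if it is an isomorphism of the underlying category. -/
def Invertible (P : NSOperad.{u}) (p : P.Op) : Prop :=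
  ∃ (q : P.Op) (hpq : [q].map P.output = P.inputs p) (hqp : [p].map P.output = P.inputs q),
    P.comp p [q] hpq = P.one (P.output p) ∧ P.comp q [p] hqp = P.one (P.output q)

/-- A non-symmetric operad is rigid if every invertible unary operation is the identity of a
colour. -/
def Rigid : ObjectProperty NSOperad.{u} := fun P =>
  ∀ p, P.Invertible p → ∃ c, p = P.one c

/-- The mirror of a non-symmetric operad: the operations are the same, but their lists of inputs
are reversed. -/
def mirrorObj (P : NSOperad.{u}) : NSOperad.{u} where
  Col := P.Col
  Op := P.Op
  inputs p := (P.inputs p).reverse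
  output := P.output
  one := P.one
  comp p qs h := P.comp p qs.reverse (by rw [List.map_reverse, h, List.reverse_reverse])
  inputs_one c := by simp [P.inputs_one]
  output_one := P.output_one
  inputs_comp p qs h := by
    rw [P.inputs_comp, List.reverse_flatMap, List.reverse_reverse]
    rfl
  output_comp p qs h := P.output_comp _ _ _
  comp_one p h := by
    have h' : ((P.inputs p).map P.one).map P.output = P.inputs p := by
      rw [List.map_map]
      exact (List.map_congr_left fun c _ => P.output_one c).trans (List.map_id _)
    exact (P.comp_congr rfl (by simp) _ h').trans (P.comp_one p h')
  one_comp p h := P.one_comp p (by simp [P.inputs_one])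
  assoc p L h h₁ h₂ := by
    -- reverse the outer list and each of the inner lists, and use associativity in `P`
    let e : {x : P.Op × List P.Op // x.2.map P.output = (P.inputs x.1).reverse} →
        {x : P.Op × List P.Op // x.2.map P.output = P.inputs x.1} := fun x =>
      ⟨(x.1.1, x.1.2.reverse), by rw [List.map_reverse, x.2, List.reverse_reverse]⟩
    have h' : ((L.map e).reverse.map fun x => x.1.1).map P.output = P.inputs p := by
      rw [← List.reverse_inj, ← h]
      simp [e]
    have key := P.assoc p (L.map e).reverse h' (P.composable_left p _ h')
      (P.composable_right p _ h')
    refine Eq.trans (P.comp_congr (P.comp_congr rfl ?_ _ _) ?_ _ _)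
      (key.trans (P.comp_congr rfl ?_ _ _))
    · simp [e]
    · rw [List.reverse_flatMap, ← List.map_reverse, List.flatMap_map]
      rfl
    · simp [e]

/-- `mirror(P)(c₁, …, cₙ; c) = P(cₙ, …, c₁; c)`. -/
theorem ops_mirrorObj (P : NSOperad.{u}) (cs : List P.Col) (c : P.Col) :
    P.mirrorObj.ops cs c = P.ops cs.reverse c := by
  ext p
  exact and_congr_left' List.reverse_eq_iff

/-- The mirror of a morphism: the same maps on colours and on operations. -/
def mirrorMap {P Q : NSOperad.{u}} (f : Hom P Q) : Hom P.mirrorObj Q.mirrorObj where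
  onCol := f.onCol
  onOp := f.onOp
  inputs_op p := (congrArg List.reverse (f.inputs_op p)).trans List.map_reverse.symm
  output_op := f.output_op
  op_one := f.op_one
  op_comp p qs h _ :=
    have h₀ : (List.reverse (α := P.Op) qs).map P.output = P.inputs p :=
      List.map_reverse.trans (List.reverse_eq_iff.2 h)
    (f.op_comp p _ h₀ (composable_map f.inputs_op f.output_op _ _ h₀)).trans
      (Q.comp_congr rfl List.map_reverse _ _)

/-- The mirror functor. -/
def mirror : NSOperad.{u} ⥤ NSOperad.{u} where
  obj := mirrorObj
  map f := mirrorMap (P := _) (Q := _) f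
  map_id _ := rfl
  map_comp _ _ := rfl

theorem rigid_mirrorObj (P : NSOperad.{u}) (hP : Rigid P) : Rigid (mirror.obj P) := by
  rintro p ⟨q, hpq, hqp, h₁, h₂⟩
  refine hP p ⟨q, ?_, ?_, h₁, h₂⟩
  · exact List.reverse_injective hpq
  · exact List.reverse_injective hqp

/-- The category of rigid non-symmetric operads, a full subcategory of `NSOperad`. -/
abbrev RigidCat : Type (u + 1) := Rigid.{u}.FullSubcategory

/-- The mirror functor on rigid non-symmetric operads. -/
def rigidMirror : RigidCat.{u} ⥤ RigidCat.{u} :=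
  Rigid.lift (Rigid.ι ⋙ mirror) fun P => rigid_mirrorObj P.obj P.property

end NSOperad

section AutoEquiv

universe v w

/-- The endofunctors of `C` that are equivalences of categories. -/
def isAutoequivalence (C : Type w) [Category.{v} C] : ObjectProperty (C ⥤ C) :=
  fun F => F.IsEquivalence

/-- The category of autoequivalences of `C`: its objects are the autoequivalences of `C`, its
morphisms are all natural transformations between them. -/
abbrev AutoEquivCat (C : Type w) [Category.{v} C] : Type (max v w) :=
  (isAutoequivalence C).FullSubcategory

attribute [local instance] endofunctorMonoidalCategory

instance (C : Type w) [Category.{v} C] : (isAutoequivalence C).IsMonoidal where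
  prop_unit := inferInstanceAs (𝟭 C).IsEquivalence
  prop_tensor F G hF hG := by
    have : F.IsEquivalence := hF
    have : G.IsEquivalence := hG
    exact inferInstanceAs (F ⋙ G).IsEquivalence

/-- The monoidal structure on autoequivalences given by composition of functors. -/
instance (C : Type w) [Category.{v} C] : MonoidalCategory (AutoEquivCat C) :=
  ObjectProperty.fullMonoidalSubcategory (isAutoequivalence C)

end AutoEquiv

universe v w

/-! ### Thin operads, discrete operads and corollas -/

namespace NSOperad

/-! An operad can be recovered from morphisms out of a few small test operads. Colours of `X` are
morphisms from the point to `X`, and operations of arity `n` are morphisms from the corolla with `n`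
inputs. An autoequivalence `F` preserves these test operads up to isomorphism, because they can be
described categorically. The point has only the identity endomorphism, has two distinct morphisms to
some object, and maps to every object that is the source of two distinct parallel morphisms
(`IsPoint`). Discrete operads are those over which every morphism surjective on colours splits,
inert morphisms are those that factor through a discrete operad, and non-inert morphisms to a
corolla split (`nonempty_corIso`). Hence `F` induces natural bijections from the colours and
operations of `X` to those of `F X`, recorded in a `Transfer`.

By naturality, what these bijections do to the ports of an operation of arity `n` is one permutation
of the `n + 1` ports of the corolla. A test operad with two colours shows that the output stays the
output (`Transfer.rootPort_eq`). In arity 2 the inputs are either kept in order or swapped; after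
composing with the mirror they may be assumed kept. A second test operad, in which nullary
operations erase all but two inputs, then forces the order to be kept in every arity
(`Transfer.inputs_op`). Partial compositions are classified by thin operads of trees with two
vertices. There an operation is determined by its inputs and output, so composition is preserved as
well (`Transfer.op_insertOp`). Thus `F` is isomorphic to the identity or to the mirror.

The point and the corollas also show that the identity functor has no endomorphism but the identity
and that there is no natural transformation from it to the mirror. Since the mirror is an
involution, the category of autoequivalences has at most one morphism between any two objects. All
monoidal coherence is then automatic.

All test operads are rigid, so the argument runs in any full subcategory that contains the rigid
operads and is stable under the mirror (`Admissible`). This treats both cases at once. -/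

theorem comp_identities (P : NSOperad.{u}) (p : P.Op) (qs : List P.Op)
    (hq : qs = (P.inputs p).map P.one) (h : qs.map P.output = P.inputs p) :
    P.comp p qs h = p := by
  subst hq
  exact P.comp_one p h

theorem identity_comp (P : NSOperad.{u}) (c : P.Col) (q : P.Op)
    (h : [q].map P.output = P.inputs (P.one c)) : P.comp (P.one c) [q] h = q := by
  obtain rfl : P.output q = c := by simpa [P.inputs_one] using h
  exact P.one_comp q h

/-- A morphism of operads may be checked to be compatible with composition on those composites
`p ∘ (q₁, …, qₙ)` in which neither `p` nor all of the `qᵢ` are identities. -/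
def homOfNontrivial {P Q : NSOperad.{u}} (col : P.Col → Q.Col) (op : P.Op → Q.Op)
    (hi : ∀ p, Q.inputs (op p) = (P.inputs p).map col)
    (ho : ∀ p, Q.output (op p) = col (P.output p))
    (h₁ : ∀ c, op (P.one c) = Q.one (col c))
    (hc : ∀ p qs (h : qs.map P.output = P.inputs p)
      (h' : (qs.map op).map Q.output = Q.inputs (op p)), (∀ c, p ≠ P.one c) →
      qs ≠ (P.inputs p).map P.one → op (P.comp p qs h) = Q.comp (op p) (qs.map op) h') :
    P ⟶ Q :=
  Hom.mk col op hi ho h₁ fun p qs h h' => by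
    by_cases hp : ∃ c, p = P.one c
    · obtain ⟨c, rfl⟩ := hp
      rw [P.inputs_one, List.map_eq_singleton_iff] at h
      obtain ⟨q, rfl, rfl⟩ := h
      rw [P.identity_comp]
      refine ((Q.comp_congr (h₁ _) rfl h' ?_).trans (Q.identity_comp (col (P.output q)) _ ?_)).symm
      all_goals simp [Q.inputs_one, ho]
    by_cases hq : qs = (P.inputs p).map P.one
    · rw [P.comp_identities p qs hq, Q.comp_identities]
      rw [hq, hi]
      simp [h₁]
    exact hc p qs h h' (fun c hc' => hp ⟨c, hc'⟩) hq

/-- A relation between lists of colours and colours that contains the identities and is closed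
under composition. -/
structure ThinRel (K : Type u) where
  rel : List K → K → Prop
  refl : ∀ c, rel [c] c
  trans : ∀ (L : List (List K × K)) (c : K), (∀ x ∈ L, rel x.1 x.2) → rel (L.map Prod.snd) c →
    rel (L.flatMap Prod.fst) c

namespace ThinRel

variable {K : Type u} (T : ThinRel K)

/-- The operad with at most one operation for given inputs and output, which exists if they are
related. -/
def operad : NSOperad.{u} where
  Col := K
  Op := {x : List K × K // T.rel x.1 x.2}
  inputs x := x.1.1
  output x := x.1.2
  one c := ⟨([c], c), T.refl c⟩
  comp p qs h := ⟨(qs.flatMap fun q => q.1.1, p.1.2), by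
    have := T.trans (qs.map Subtype.val) p.1.2 (by
      intro x hx
      obtain ⟨y, -, rfl⟩ := List.mem_map.1 hx
      exact y.2) (by
      have hp := p.2
      rw [← h] at hp
      simpa [Function.comp_def] using hp)
    simpa [List.flatMap_map] using this⟩
  inputs_one _ := rfl
  output_one _ := rfl
  inputs_comp _ _ _ := rfl
  output_comp _ _ _ := rfl
  comp_one p h := Subtype.ext (Prod.ext (by simp [List.flatMap_map]) rfl)
  one_comp p h := Subtype.ext (Prod.ext (by simp) rfl)
  assoc p L h h₁ h₂ := Subtype.ext (Prod.ext (by simp [List.flatMap_map, List.flatMap_assoc]) rfl)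

/-- The operation with given inputs and output. -/
def op {l : List K} {c : K} (h : T.rel l c) : T.operad.Op := ⟨(l, c), h⟩

variable {T}

theorem op_ext {p q : T.operad.Op} (h : T.operad.inputs p = T.operad.inputs q)
    (h' : T.operad.output p = T.operad.output q) : p = q :=
  Subtype.ext (Prod.ext h h')

theorem eq_one_iff {p : T.operad.Op} :
    (∃ c, p = T.operad.one c) ↔ T.operad.inputs p = [T.operad.output p] := by
  constructor
  · rintro ⟨c, rfl⟩
    rfl
  · intro h
    exact ⟨_, op_ext h rfl⟩

/-- An invertible operation and its inverse relate two colours in both directions. Antisymmetry on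
unary operations is therefore enough, since an operation from `[x]` to `x` must be the identity. -/
theorem rigid (h : ∀ x y, T.rel [x] y → T.rel [y] x → x = y) : Rigid T.operad := by
  rintro ⟨⟨l, y⟩, hp⟩ ⟨⟨⟨l', x⟩, hq⟩, hpq, hqp, -⟩
  obtain rfl : [x] = l := hpq
  obtain rfl : [y] = l' := hqp
  obtain rfl := h x y hp hq
  exact ⟨x, rfl⟩

end ThinRel

/-- The discrete operad on a set of colours. -/
def discRel (S : Type u) : ThinRel S where
  rel l c := l = [c]
  refl _ := rfl
  trans L c hL h := by
    rw [List.map_eq_singleton_iff] at h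
    obtain ⟨x, rfl, rfl⟩ := h
    simpa using hL x (by simp)

theorem discRel_rigid (S : Type u) : Rigid (discRel S).operad :=
  ThinRel.rigid fun _ _ h _ => List.head_eq_of_cons_eq h

theorem discRel_eq_one {S : Type u} (p : (discRel S).operad.Op) :
    ∃ c, p = (discRel S).operad.one c :=
  ThinRel.eq_one_iff.2 p.2

/-- The morphism from a discrete operad given by a map on colours. -/
def discHom {S : Type u} {P : NSOperad.{u}} (f : S → P.Col) : (discRel S).operad ⟶ P :=
  homOfNontrivial f (fun p => P.one (f p.1.2))
    (fun p => by rw [P.inputs_one]; obtain ⟨c, rfl⟩ := discRel_eq_one p; rfl)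
    (fun p => P.output_one _) (fun c => rfl)
    (fun p _ _ _ hp => by obtain ⟨c, rfl⟩ := discRel_eq_one p; exact absurd rfl (hp c))

/-- The colours of the corolla with `n` inputs. -/
inductive CorCol (n : ℕ) : Type u
  | root : CorCol n
  | leaf : Fin n → CorCol n

/-- The input colours of the operation of the corolla. -/
def corLeaves (n : ℕ) : List (CorCol.{u} n) := (List.finRange n).map CorCol.leaf

/-- The corolla with `n` inputs. -/
def corRel (n : ℕ) : ThinRel (CorCol.{u} n) where
  rel l c := l = [c] ∨ c = .root ∧ l = corLeaves n
  refl _ := Or.inl rfl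
  trans L c hL h := by
    obtain h | ⟨rfl, h⟩ := h
    · rw [List.map_eq_singleton_iff] at h
      obtain ⟨x, rfl, rfl⟩ := h
      simpa using hL x (by simp)
    · refine Or.inr ⟨rfl, ?_⟩
      rw [← h, ← List.flatMap_pure_eq_map]
      -- Only identities can be plugged into the leaves: the other operation has output `root`,
      -- which is not a leaf.
      refine List.flatMap_congr fun x hx => (hL x hx).resolve_right ?_
      rintro ⟨hx', -⟩
      have : x.2 ∈ corLeaves n := h ▸ List.mem_map_of_mem hx
      simp [corLeaves, hx'] at this

theorem corRel_rigid (n : ℕ) : Rigid (corRel.{u} n).operad := by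
  refine ThinRel.rigid fun x y h h' => ?_
  obtain h | ⟨rfl, h⟩ := h
  · simpa using h
  obtain h' | ⟨rfl, h'⟩ := h'
  · simpa using h'.symm
  · rfl

/-- The operation of the corolla. -/
def corTop (n : ℕ) : (corRel.{u} n).operad.Op := (corRel n).op (Or.inr ⟨rfl, rfl⟩)

theorem corTop_inputs (n : ℕ) : (corRel.{u} n).operad.inputs (corTop n) = corLeaves n := rfl

theorem corTop_output (n : ℕ) : (corRel.{u} n).operad.output (corTop n) = CorCol.root := rfl

theorem root_notMem_corLeaves (n : ℕ) : CorCol.root ∉ corLeaves.{u} n := by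
  simp [corLeaves]

theorem corTop_ne_one (n : ℕ) (c) : corTop.{u} n ≠ (corRel.{u} n).operad.one c := by
  intro h
  have := ThinRel.eq_one_iff.1 ⟨c, h⟩
  rw [corTop_inputs, corTop_output] at this
  exact root_notMem_corLeaves n (this ▸ List.mem_singleton_self _)

theorem corRel_cases {n : ℕ} (p : (corRel.{u} n).operad.Op) :
    (∃ c, p = (corRel n).operad.one c) ∨ p = corTop n := by
  obtain ⟨⟨l, c⟩, h | ⟨h, h'⟩⟩ := p
  · exact Or.inl ⟨c, ThinRel.op_ext h rfl⟩
  · exact Or.inr (ThinRel.op_ext h' h)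

/-- The colours of an operation of arity `n`. -/
def portCol (P : NSOperad.{u}) (x : P.Op) {n : ℕ} (h : (P.inputs x).length = n) :
    CorCol.{u} n → P.Col
  | .root => P.output x
  | .leaf i => (P.inputs x)[i]

theorem map_portCol_corLeaves (P : NSOperad.{u}) (x : P.Op) {n : ℕ}
    (h : (P.inputs x).length = n) : (corLeaves n).map (P.portCol x h) = P.inputs x := by
  subst h
  simp only [corLeaves, List.map_map]
  exact List.map_getElem_finRange _

open Classical in
/-- The morphism from the corolla given by an operation of arity `n`. -/
noncomputable def corHom (P : NSOperad.{u}) (x : P.Op) {n : ℕ} (h : (P.inputs x).length = n) :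
    (corRel.{u} n).operad ⟶ P :=
  homOfNontrivial (P.portCol x h)
    (fun p => if p = corTop n then x else P.one (P.portCol x h p.1.2))
    (fun p => by
      obtain ⟨c, rfl⟩ | rfl := corRel_cases p
      · rw [if_neg (corTop_ne_one n c).symm, P.inputs_one]
        rfl
      · rw [if_pos rfl]
        exact (P.map_portCol_corLeaves x h).symm)
    (fun p => by
      obtain ⟨c, rfl⟩ | rfl := corRel_cases p
      · rw [if_neg (corTop_ne_one n c).symm, P.output_one]
        rfl
      · rw [if_pos rfl]
        rfl)
    (fun c => if_neg (corTop_ne_one n c).symm)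
    -- A corolla has no nontrivial composite: whatever is plugged into its operation has a leaf as
    -- output, hence is an identity.
    (fun p qs h _ hp hq => by
      obtain ⟨c, rfl⟩ | rfl := corRel_cases p
      · exact absurd rfl (hp c)
      refine absurd ?_ hq
      rw [← h, List.map_map]
      conv_lhs => rw [← List.map_id qs]
      refine List.map_congr_left fun q hqs => ?_
      obtain ⟨c, rfl⟩ | rfl := corRel_cases q
      · rfl
      · have : CorCol.root ∈ corLeaves n := by
          rw [← corTop_inputs, ← h]
          exact List.mem_map_of_mem hqs
        exact absurd this (root_notMem_corLeaves n))

theorem corHom_corTop (P : NSOperad.{u}) (x : P.Op) {n : ℕ} (h : (P.inputs x).length = n) :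
    Hom.onOp (P.corHom x h) (corTop n) = x := if_pos rfl

theorem map_eq_one {P Q : NSOperad.{u}} (f : P ⟶ Q) {p : P.Op} (h : ∃ c, p = P.one c) :
    ∃ c, Hom.onOp f p = Q.one c := by
  obtain ⟨c, rfl⟩ := h
  exact ⟨_, Hom.op_one f c⟩

theorem eq_of_one (P : NSOperad.{u}) {p : P.Op} (h : ∃ c, p = P.one c) :
    p = P.one (P.output p) := by
  obtain ⟨c, rfl⟩ := h
  rw [P.output_one]

theorem onOp_one_of {P Q : NSOperad.{u}} (f : P ⟶ Q) {p : P.Op} (h : ∃ c, p = P.one c) :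
    Hom.onOp f p = Q.one (Hom.onCol f (P.output p)) := by
  conv_lhs => rw [P.eq_of_one h]
  exact Hom.op_one f _

/-- Morphisms from a corolla are determined by the image of its operation. -/
theorem corRel_hom_ext {P : NSOperad.{u}} {n : ℕ} {f g : (corRel.{u} n).operad ⟶ P}
    (h : Hom.onOp f (corTop n) = Hom.onOp g (corTop n)) : f = g := by
  have hcol : Hom.onCol f = Hom.onCol g := by
    funext c
    cases c with
    | root =>
      have := congrArg P.output h
      rwa [Hom.output_op f, Hom.output_op g] at this
    | leaf i =>
      have := congrArg P.inputs h
      rw [Hom.inputs_op f, Hom.inputs_op g] at this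
      exact List.map_inj_left.1 this _ (List.mem_map_of_mem (List.mem_finRange i))
  refine Hom.ext hcol (funext fun p => ?_)
  obtain ⟨c, rfl⟩ | rfl := corRel_cases p
  · rw [Hom.op_one f, Hom.op_one g, hcol]
  · exact h

/-- Morphisms from a discrete operad are determined by the map on colours. -/
theorem discRel_hom_ext {P : NSOperad.{u}} {S : Type u} {f g : (discRel S).operad ⟶ P}
    (h : Hom.onCol f = Hom.onCol g) : f = g :=
  Hom.ext h (funext fun p => by
    rw [onOp_one_of f (discRel_eq_one p), onOp_one_of g (discRel_eq_one p), h])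

end NSOperad

/-! ### Natural transformations between the identity and the mirror -/

namespace NSOperad

/-- A class of operads that contains the rigid operads and is stable under taking mirrors. -/
class Admissible (𝒬 : ObjectProperty NSOperad.{u}) : Prop where
  of_rigid : ∀ P, Rigid P → 𝒬 P
  mirror_obj : ∀ P, 𝒬 P → 𝒬 (mirror.obj P)

instance : Admissible Rigid.{u} where
  of_rigid _ h := h
  mirror_obj := rigid_mirrorObj

instance : Admissible (⊤ : ObjectProperty NSOperad.{u}) where
  of_rigid _ _ := trivial
  mirror_obj _ _ := trivial

section

variable {𝒬 : ObjectProperty NSOperad.{u}}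

/-- The map on colours of a morphism in a full subcategory of operads. -/
def colMap {X Y : 𝒬.FullSubcategory} (f : X ⟶ Y) : X.obj.Col → Y.obj.Col := Hom.onCol f.hom

/-- The map on operations of a morphism in a full subcategory of operads. -/
def opMap {X Y : 𝒬.FullSubcategory} (f : X ⟶ Y) : X.obj.Op → Y.obj.Op := Hom.onOp f.hom

theorem colMap_comp {X Y Z : 𝒬.FullSubcategory} (f : X ⟶ Y) (g : Y ⟶ Z) (c : X.obj.Col) :
    colMap (f ≫ g) c = colMap g (colMap f c) := rfl

theorem opMap_comp {X Y Z : 𝒬.FullSubcategory} (f : X ⟶ Y) (g : Y ⟶ Z) (p : X.obj.Op) :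
    opMap (f ≫ g) p = opMap g (opMap f p) := rfl

theorem colMap_id {X : 𝒬.FullSubcategory} (c : X.obj.Col) : colMap (𝟙 X) c = c := rfl

theorem opMap_id {X : 𝒬.FullSubcategory} (p : X.obj.Op) : opMap (𝟙 X) p = p := rfl

theorem inputs_opMap {X Y : 𝒬.FullSubcategory} (f : X ⟶ Y) (p : X.obj.Op) :
    Y.obj.inputs (opMap f p) = (X.obj.inputs p).map (colMap f) := Hom.inputs_op f.hom p

theorem output_opMap {X Y : 𝒬.FullSubcategory} (f : X ⟶ Y) (p : X.obj.Op) :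
    Y.obj.output (opMap f p) = colMap f (X.obj.output p) := Hom.output_op f.hom p

theorem opMap_one {X Y : 𝒬.FullSubcategory} (f : X ⟶ Y) (c : X.obj.Col) :
    opMap f (X.obj.one c) = Y.obj.one (colMap f c) := Hom.op_one f.hom c

theorem opMap_eq_one {X Y : 𝒬.FullSubcategory} (f : X ⟶ Y) {p : X.obj.Op}
    (h : ∃ c, p = X.obj.one c) : ∃ c, opMap f p = Y.obj.one c := map_eq_one f.hom h

theorem full_hom_ext {X Y : 𝒬.FullSubcategory} {f g : X ⟶ Y}
    (hc : ∀ c, colMap f c = colMap g c) (ho : ∀ p, opMap f p = opMap g p) : f = g :=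
  ObjectProperty.hom_ext _ (Hom.ext (funext hc) (funext ho))

theorem length_inputs_opMap {X Y : 𝒬.FullSubcategory} (f : X ⟶ Y) (p : X.obj.Op) :
    (Y.obj.inputs (opMap f p)).length = (X.obj.inputs p).length := by
  rw [inputs_opMap, List.length_map]

variable [Admissible 𝒬]

variable (𝒬) in
/-- The operad associated with a thin relation, as an object of a class of operads that contains
the rigid ones. -/
def thin {K : Type u} (T : ThinRel K) (h : Rigid T.operad) : 𝒬.FullSubcategory :=
  ⟨T.operad, Admissible.of_rigid _ h⟩

variable (𝒬) in
/-- The discrete operad on a set of colours. -/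
def disc (S : Type u) : 𝒬.FullSubcategory := thin 𝒬 (discRel S) (discRel_rigid S)

variable (𝒬) in
/-- The corolla with `n` inputs. -/
def cor (n : ℕ) : 𝒬.FullSubcategory := thin 𝒬 (corRel n) (corRel_rigid n)

/-- The morphism from a discrete operad given by a map on colours. -/
def ofDisc {S : Type u} {X : 𝒬.FullSubcategory} (f : S → X.obj.Col) : disc 𝒬 S ⟶ X :=
  ObjectProperty.homMk (discHom f)

theorem disc_eq_one {S : Type u} (p : (disc 𝒬 S).obj.Op) : ∃ c, p = (disc 𝒬 S).obj.one c :=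
  discRel_eq_one p

theorem disc_hom_ext {S : Type u} {X : 𝒬.FullSubcategory} {f g : disc 𝒬 S ⟶ X}
    (h : ∀ s, colMap f s = colMap g s) : f = g :=
  ObjectProperty.hom_ext _ (discRel_hom_ext (funext h))

/-- The operation of the corolla. -/
def top (n : ℕ) : (cor 𝒬 n).obj.Op := corTop n

/-- The morphism from the corolla given by an operation of arity `n`. -/
noncomputable def ofCor (X : 𝒬.FullSubcategory) (x : X.obj.Op) {n : ℕ}
    (h : (X.obj.inputs x).length = n) : cor 𝒬 n ⟶ X :=
  ObjectProperty.homMk (X.obj.corHom x h)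

theorem opMap_ofCor (X : 𝒬.FullSubcategory) (x : X.obj.Op) {n : ℕ}
    (h : (X.obj.inputs x).length = n) : opMap (ofCor X x h) (top n) = x :=
  X.obj.corHom_corTop x h

theorem cor_hom_ext {n : ℕ} {X : 𝒬.FullSubcategory} {f g : cor 𝒬 n ⟶ X}
    (h : opMap f (top n) = opMap g (top n)) : f = g :=
  ObjectProperty.hom_ext _ (corRel_hom_ext h)

theorem length_inputs_top (n : ℕ) : ((cor 𝒬 n).obj.inputs (top n)).length = n := by
  change (corLeaves n).length = n
  simp [corLeaves]

variable (𝒬) in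
/-- The mirror functor on a full subcategory of operads. -/
def mirrorFull : 𝒬.FullSubcategory ⥤ 𝒬.FullSubcategory :=
  𝒬.lift (𝒬.ι ⋙ mirror) fun P => Admissible.mirror_obj P.obj P.property

/-- A colour is a morphism from the point, and the component of `α` at the point can only fix its
single colour; naturality does the rest. -/
theorem colMap_app_eq (α : 𝟭 𝒬.FullSubcategory ⟶ 𝟭 _) (X : 𝒬.FullSubcategory)
    (c : X.obj.Col) : colMap (α.app X) c = c :=
  congrArg (fun f => colMap f PUnit.unit)
    (α.naturality (ofDisc fun _ : PUnit => c))

/-- Colours are fixed, and in a corolla an operation is determined by its inputs and output, so the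
operation of each corolla is fixed. Every operation is the image of one of these. -/
theorem natTrans_id_id (α : 𝟭 𝒬.FullSubcategory ⟶ 𝟭 _) : α = 𝟙 _ := by
  have hcor (n : ℕ) : opMap (α.app (cor 𝒬 n)) (top n) = top n := by
    refine ThinRel.op_ext (T := corRel n) ?_ ?_
    · refine (inputs_opMap (α.app (cor 𝒬 n)) (top n)).trans ?_
      exact (List.map_congr_left fun c _ => colMap_app_eq α _ c).trans (List.map_id _)
    · exact (output_opMap (α.app (cor 𝒬 n)) (top n)).trans (colMap_app_eq α _ _)
  ext X : 2
  refine full_hom_ext (colMap_app_eq α X) fun p => ?_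
  have h : opMap (α.app X) (opMap (ofCor X p rfl) (top _)) =
      opMap (ofCor X p rfl) (opMap (α.app (cor 𝒬 _)) (top _)) :=
    congrArg (fun f => opMap f (top _)) (α.naturality (ofCor X p rfl))
  rw [hcor] at h
  have h' := opMap_ofCor X p rfl
  exact (congrArg (opMap (α.app X)) h').symm.trans (h.trans h')

/-- Such a transformation would fix colours, so the binary corolla would need an operation whose
inputs are its two distinct leaves in the opposite order. -/
theorem isEmpty_natTrans_id_mirror : IsEmpty (𝟭 𝒬.FullSubcategory ⟶ mirrorFull 𝒬) := by
  refine ⟨fun α => ?_⟩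
  have hcol (X : 𝒬.FullSubcategory) (c : X.obj.Col) : colMap (α.app X) c = c :=
    congrArg (fun f => colMap f PUnit.unit) (α.naturality (ofDisc fun _ : PUnit => c))
  have hin := inputs_opMap (α.app (cor 𝒬 2)) (top 2)
  have hmap : List.map (colMap (α.app (cor 𝒬 2))) ((cor 𝒬 2).obj.inputs (top 2)) =
      corLeaves 2 :=
    (List.map_congr_left fun c _ => hcol _ c).trans (List.map_id _)
  have hin' : ((corRel 2).operad.inputs (opMap (α.app (cor 𝒬 2)) (top 2))).reverse =
    corLeaves 2 := hin.trans hmap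
  generalize hq : (show (corRel 2).operad.Op from opMap (α.app (cor 𝒬 2)) (top 2)) = q at hin'
  replace hin' : ((corRel 2).operad.inputs q).reverse = corLeaves 2 := hq ▸ hin'
  obtain ⟨c, rfl⟩ | rfl := corRel_cases q
  · exact absurd (congrArg List.length hin') (by
      change ([c].reverse).length ≠ (corLeaves 2).length
      simp [corLeaves])
  · rw [corTop_inputs] at hin'
    have : (CorCol.leaf 1 : CorCol 2) = CorCol.leaf 0 := List.head_eq_of_cons_eq hin'
    simp at this

end

end NSOperad

/-! ### Partial composition and trees with two vertices -/

namespace NSOperad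

theorem isIso_of_bijective {P Q : NSOperad.{u}} (f : P ⟶ Q)
    (hc : Function.Bijective (Hom.onCol f)) (ho : Function.Bijective (Hom.onOp f)) :
    IsIso f := by
  let col := Equiv.ofBijective _ hc
  let op := Equiv.ofBijective _ ho
  have hi (p : Q.Op) : P.inputs (op.symm p) = (Q.inputs p).map col.symm := by
    obtain ⟨p, rfl⟩ := op.surjective p
    rw [op.symm_apply_apply]
    refine (List.map_id _).symm.trans ?_
    refine Eq.trans ?_ (congrArg (List.map col.symm) (Hom.inputs_op f p).symm)
    rw [List.map_map]
    exact List.map_congr_left fun c _ => (col.symm_apply_apply c).symm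
  have hout (p : Q.Op) : P.output (op.symm p) = col.symm (Q.output p) := by
    obtain ⟨p, rfl⟩ := op.surjective p
    rw [op.symm_apply_apply, Equiv.eq_symm_apply]
    exact (Hom.output_op f p).symm
  let g : Q ⟶ P := Hom.mk col.symm op.symm hi hout
    (fun c => by
      obtain ⟨c, rfl⟩ := col.surjective c
      rw [Equiv.symm_apply_eq, col.symm_apply_apply]
      exact (Hom.op_one f c).symm)
    (fun p qs h h' => by
      rw [Equiv.symm_apply_eq]
      refine Eq.trans (Q.comp_congr ?_ ?_ _ ?_) (Hom.op_comp f _ _ h' ?_).symm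
      · exact (op.apply_symm_apply p).symm
      · rw [List.map_map]
        refine (List.map_id _).symm.trans (List.map_congr_left fun c _ => ?_)
        exact (op.apply_symm_apply c).symm
      all_goals exact composable_map (Hom.inputs_op f) (Hom.output_op f) _ _ h')
  exact ⟨g, Hom.ext (funext col.symm_apply_apply) (funext op.symm_apply_apply),
    Hom.ext (funext col.apply_symm_apply) (funext op.apply_symm_apply)⟩

theorem map_output_map_one (P : NSOperad.{u}) (l : List P.Col) :
    (l.map P.one).map P.output = l := by
  rw [List.map_map]
  exact (List.map_congr_left fun c _ => P.output_one c).trans (List.map_id _)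

theorem flatMap_inputs_map_one (P : NSOperad.{u}) (l : List P.Col) :
    (l.map P.one).flatMap P.inputs = l := by
  rw [List.flatMap_map]
  simp [P.inputs_one]

/-- The partial composite `p ∘ (1, …, 1, q, 1, …, 1)`. -/
def insertOp (P : NSOperad.{u}) (p q : P.Op) (l r : List P.Col)
    (h : P.inputs p = l ++ P.output q :: r) : P.Op :=
  P.comp p (l.map P.one ++ q :: r.map P.one) (by
    rw [h, List.map_append, List.map_cons, P.map_output_map_one, P.map_output_map_one])

theorem insertOp_congr (P : NSOperad.{u}) {p q p' q' : P.Op} {l r l' r' : List P.Col}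
    (hp : p = p') (hq : q = q') (hl : l = l') (hr : r = r')
    (h : P.inputs p = l ++ P.output q :: r) (h' : P.inputs p' = l' ++ P.output q' :: r') :
    P.insertOp p q l r h = P.insertOp p' q' l' r' h' := by
  subst hp hq hl hr
  rfl

theorem inputs_insertOp (P : NSOperad.{u}) (p q : P.Op) (l r : List P.Col)
    (h : P.inputs p = l ++ P.output q :: r) :
    P.inputs (P.insertOp p q l r h) = l ++ P.inputs q ++ r := by
  rw [insertOp, P.inputs_comp, List.flatMap_append, List.flatMap_cons, P.flatMap_inputs_map_one,
    P.flatMap_inputs_map_one, List.append_assoc]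

theorem output_insertOp (P : NSOperad.{u}) (p q : P.Op) (l r : List P.Col)
    (h : P.inputs p = l ++ P.output q :: r) :
    P.output (P.insertOp p q l r h) = P.output p := P.output_comp _ _ _

theorem insertable_map {P Q : NSOperad.{u}} {col : P.Col → Q.Col} {op : P.Op → Q.Op}
    (hi : ∀ p, Q.inputs (op p) = (P.inputs p).map col)
    (ho : ∀ p, Q.output (op p) = col (P.output p)) {p q : P.Op} {l r : List P.Col}
    (h : P.inputs p = l ++ P.output q :: r) :
    Q.inputs (op p) = l.map col ++ Q.output (op q) :: r.map col := by
  rw [hi, h, ho]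
  simp

theorem onOp_insertOp {P Q : NSOperad.{u}} (f : P ⟶ Q) (p q : P.Op) (l r : List P.Col)
    (h : P.inputs p = l ++ P.output q :: r) :
    Hom.onOp f (P.insertOp p q l r h) =
      Q.insertOp (Hom.onOp f p) (Hom.onOp f q) (l.map (Hom.onCol f)) (r.map (Hom.onCol f))
        (insertable_map (Hom.inputs_op f) (Hom.output_op f) h) := by
  refine (Hom.op_comp f _ _ _ ?_).trans (Q.comp_congr rfl ?_ _ _)
  · exact composable_map (Hom.inputs_op f) (Hom.output_op f) _ _ (by
      rw [h, List.map_append, List.map_cons, P.map_output_map_one, P.map_output_map_one])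
  · simp [Function.comp_def, Hom.op_one f]

/-- Composing with several operations can be done by inserting the first of them, and then
composing with the others. -/
theorem comp_cons (P : NSOperad.{u}) (p q : P.Op) (l : List P.Col) (qs : List P.Op)
    (h : (l.map P.one ++ q :: qs).map P.output = P.inputs p)
    (h₁ : P.inputs p = l ++ P.output q :: qs.map P.output)
    (h₂ : ((l ++ P.inputs q).map P.one ++ qs).map P.output =
      P.inputs (P.insertOp p q l (qs.map P.output) h₁)) :
    P.comp p (l.map P.one ++ q :: qs) h =
      P.comp (P.insertOp p q l (qs.map P.output) h₁) ((l ++ P.inputs q).map P.one ++ qs) h₂ := by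
  -- Associativity is applied with `q` in the outer layer and each element of `qs` in the inner
  -- layer, all other places being filled with identities. One bracketing then inserts `q` first,
  -- the other composes everything at once.
  let L : List {x : P.Op × List P.Op // x.2.map P.output = P.inputs x.1} :=
    l.map (fun c => ⟨(P.one c, [P.one c]), by simp [P.inputs_one, P.output_one]⟩) ++
    ⟨(q, (P.inputs q).map P.one), P.map_output_map_one _⟩ ::
    qs.map (fun x => ⟨(P.one (P.output x), [x]), by simp [P.inputs_one]⟩)
  have hL : (L.map fun x => x.1.1).map P.output = P.inputs p := by
    rw [h₁]
    simp [L, P.output_one, Function.comp_def]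
  have key := P.assoc p L hL (P.composable_left p L hL) (P.composable_right p L hL)
  refine Eq.trans (P.comp_congr rfl ?_ _ _) (key.symm.trans
    (P.comp_congr (P.comp_congr rfl ?_ _ _) ?_ _ _))
  · simp [L, P.comp_identities, Function.comp_def, P.identity_comp]
  · simp [L, Function.comp_def]
  · simp [L, List.flatMap_map, ← List.map_eq_flatMap]

/-- Maps on colours and on operations form a morphism if they are compatible with identities and
with partial composition. -/
def homOfInsert {P Q : NSOperad.{u}} (col : P.Col → Q.Col) (op : P.Op → Q.Op)
    (hi : ∀ p, Q.inputs (op p) = (P.inputs p).map col)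
    (ho : ∀ p, Q.output (op p) = col (P.output p))
    (h₁ : ∀ c, op (P.one c) = Q.one (col c))
    (hc : ∀ p q l r (h : P.inputs p = l ++ P.output q :: r),
      op (P.insertOp p q l r h) =
        Q.insertOp (op p) (op q) (l.map col) (r.map col) (insertable_map hi ho h)) :
    P ⟶ Q :=
  Hom.mk col op hi ho h₁ fun p qs h h' => by
    -- For the induction, `p` and a prefix `l` of inputs already filled with identities must vary:
    -- inserting the first operation of `qs` replaces `p` by the partial composite and moves the new
    -- inputs into the prefix.
    suffices H : ∀ (qs : List P.Op) (p : P.Op) (l : List P.Col)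
        (h : (l.map P.one ++ qs).map P.output = P.inputs p)
        (h' : ((l.map col).map Q.one ++ qs.map op).map Q.output = Q.inputs (op p)),
        op (P.comp p (l.map P.one ++ qs) h) =
          Q.comp (op p) ((l.map col).map Q.one ++ qs.map op) h' from H qs p [] h h'
    clear h h' qs p
    intro qs
    induction qs with
    | nil =>
      intro p l h h'
      have hl : l = P.inputs p := by
        rw [← h, List.append_nil, P.map_output_map_one]
      rw [P.comp_identities _ _ (by rw [hl, List.append_nil]),
        Q.comp_identities _ _ (by rw [hl, hi, List.map_nil, List.append_nil])]
    | cons q qs ih =>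
      intro p l h h'
      have h₁ : P.inputs p = l ++ P.output q :: qs.map P.output := by
        rw [← h, List.map_append, P.map_output_map_one, List.map_cons]
      have h₂ : ((l ++ P.inputs q).map P.one ++ qs).map P.output =
          P.inputs (P.insertOp p q l (qs.map P.output) h₁) := by
        rw [P.inputs_insertOp, List.map_append, P.map_output_map_one]
      have hqs : (qs.map op).map Q.output = (qs.map P.output).map col := by
        rw [List.map_map, List.map_map]
        exact List.map_congr_left fun x _ => ho x
      have h₁' : Q.inputs (op p) =
          l.map col ++ Q.output (op q) :: (qs.map op).map Q.output := by
        rw [hqs]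
        exact insertable_map hi ho h₁
      have h₂' : ((l.map col ++ Q.inputs (op q)).map Q.one ++ qs.map op).map Q.output =
          Q.inputs (Q.insertOp (op p) (op q) (l.map col) ((qs.map op).map Q.output) h₁') := by
        rw [Q.inputs_insertOp, List.map_append, Q.map_output_map_one]
      have hop : op (P.insertOp p q l (qs.map P.output) h₁) =
          Q.insertOp (op p) (op q) (l.map col) ((qs.map op).map Q.output) h₁' :=
        (hc p q l _ h₁).trans (Q.insertOp_congr rfl rfl rfl hqs.symm _ _)
      have hl : (l ++ P.inputs q).map col = l.map col ++ Q.inputs (op q) := by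
        rw [List.map_append, hi]
      rw [P.comp_cons p q l qs h h₁ h₂, ih _ _ h₂ (by rw [hop, hl, h₂'])]
      refine Eq.trans (Q.comp_congr hop (by rw [hl]) _ h₂') ?_
      exact (Q.comp_cons (op p) (op q) (l.map col) (qs.map op) h' h₁' h₂').symm

/-- The colours of the tree with two vertices, the lower one having `a` inputs on the left and `b`
inputs on the right of the inner edge, the upper one having `s` inputs. -/
inductive GraftCol (a b s : ℕ) : Type u
  | left : Fin a → GraftCol a b s
  | right : Fin b → GraftCol a b s
  | inner : Fin s → GraftCol a b s
  | mid : GraftCol a b s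
  | root : GraftCol a b s

namespace GraftCol

variable (a b s : ℕ)

/-- The inputs of the lower vertex on the left of the inner edge. -/
def lefts : List (GraftCol.{u} a b s) := (List.finRange a).map left

/-- The inputs of the lower vertex on the right of the inner edge. -/
def rights : List (GraftCol.{u} a b s) := (List.finRange b).map right

/-- The inputs of the upper vertex. -/
def inners : List (GraftCol.{u} a b s) := (List.finRange s).map inner

variable {a b s}

/-- The height of an edge, seen from the leaves. -/
def rank : GraftCol.{u} a b s → ℕ
  | mid => 1
  | root => 2
  | _ => 0

theorem rank_of_mem_lefts {c : GraftCol.{u} a b s} (h : c ∈ lefts a b s) : c.rank = 0 := by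
  obtain ⟨i, -, rfl⟩ := List.mem_map.1 h
  rfl

theorem rank_of_mem_rights {c : GraftCol.{u} a b s} (h : c ∈ rights a b s) : c.rank = 0 := by
  obtain ⟨i, -, rfl⟩ := List.mem_map.1 h
  rfl

theorem rank_of_mem_inners {c : GraftCol.{u} a b s} (h : c ∈ inners a b s) : c.rank = 0 := by
  obtain ⟨i, -, rfl⟩ := List.mem_map.1 h
  rfl

theorem rank_of_mem_whole {c : GraftCol.{u} a b s}
    (h : c ∈ lefts a b s ++ inners a b s ++ rights a b s) : c.rank = 0 := by
  simp only [List.mem_append] at h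
  obtain (h | h) | h := h
  · exact rank_of_mem_lefts h
  · exact rank_of_mem_inners h
  · exact rank_of_mem_rights h

/-- The operations of the tree with two vertices. -/
inductive Rel : List (GraftCol.{u} a b s) → GraftCol.{u} a b s → Prop
  | one (c) : Rel [c] c
  | lower : Rel (lefts a b s ++ mid :: rights a b s) root
  | upper : Rel (inners a b s) mid
  | whole : Rel (lefts a b s ++ inners a b s ++ rights a b s) root

/-- Since non-identity operations strictly increase the rank, no two of them can be mutually
inverse; this gives rigidity of the tree. -/
theorem Rel.eq_or_rank_lt {l : List (GraftCol.{u} a b s)} {c : GraftCol.{u} a b s}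
    (h : Rel l c) : l = [c] ∨ ∀ x ∈ l, x.rank < c.rank := by
  cases h with
  | one => exact Or.inl rfl
  | lower =>
    refine Or.inr fun x hx => ?_
    simp only [List.mem_append, List.mem_cons] at hx
    obtain h | rfl | h := hx
    · rw [rank_of_mem_lefts h]; simp [rank]
    · simp [rank]
    · rw [rank_of_mem_rights h]; simp [rank]
  | upper =>
    refine Or.inr fun x hx => ?_
    rw [rank_of_mem_inners hx]; simp [rank]
  | whole =>
    exact Or.inr fun x hx => by rw [rank_of_mem_whole hx]; simp [rank]

theorem Rel.eq_of_rank {l : List (GraftCol.{u} a b s)} {c : GraftCol.{u} a b s}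
    (h : Rel l c) (hc : c.rank = 0) : l = [c] := by
  cases h with
  | one => rfl
  | lower => simp [rank] at hc
  | upper => simp [rank] at hc
  | whole => simp [rank] at hc

theorem flatMap_eq_of_rank (L : List (List (GraftCol.{u} a b s) × GraftCol.{u} a b s))
    (hL : ∀ x ∈ L, Rel x.1 x.2) (h : ∀ c ∈ L.map Prod.snd, c.rank = 0) :
    L.flatMap Prod.fst = L.map Prod.snd := by
  rw [← List.flatMap_pure_eq_map]
  exact List.flatMap_congr fun x hx => (hL x hx).eq_of_rank (h _ (List.mem_map_of_mem hx))

end GraftCol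

open GraftCol in
/-- The operad of the tree with two vertices. -/
def graftRel (a b s : ℕ) : ThinRel (GraftCol.{u} a b s) where
  rel := Rel
  refl := Rel.one
  trans L c hL h := by
    generalize hl : L.map Prod.snd = l at h
    cases h with
    | one =>
      rw [List.map_eq_singleton_iff] at hl
      obtain ⟨x, rfl, rfl⟩ := hl
      simpa using hL x (by simp)
    | lower =>
      rw [List.map_eq_append_iff] at hl
      obtain ⟨L₁, L₂, rfl, h₁, h₂⟩ := hl
      rw [List.map_eq_cons_iff] at h₂
      obtain ⟨x, L₃, rfl, hx, h₃⟩ := h₂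
      rw [List.flatMap_append, List.flatMap_cons,
        flatMap_eq_of_rank L₁ (fun y hy => hL y (by simp [hy]))
          (fun c hc => rank_of_mem_lefts (h₁ ▸ hc)),
        flatMap_eq_of_rank L₃ (fun y hy => hL y (by simp [hy]))
          (fun c hc => rank_of_mem_rights (h₃ ▸ hc)), h₁, h₃]
      -- All other inputs are leaves and receive identities. Only the inner edge leaves a choice:
      -- the identity gives the lower vertex back, the upper vertex gives the composite of the tree.
      have hx' := hL x (by simp)
      rw [hx] at hx'
      generalize x.1 = m at hx'
      cases hx' with
      | one => exact Rel.lower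
      | upper => rw [← List.append_assoc]; exact Rel.whole
    | upper =>
      rw [flatMap_eq_of_rank L hL (fun c hc => rank_of_mem_inners (hl ▸ hc)), hl]
      exact Rel.upper
    | whole =>
      rw [flatMap_eq_of_rank L hL (fun c hc => rank_of_mem_whole (hl ▸ hc)), hl]
      exact Rel.whole

theorem graftRel_rigid (a b s : ℕ) : Rigid (graftRel.{u} a b s).operad := by
  refine ThinRel.rigid fun x y h h' => ?_
  obtain h | h := GraftCol.Rel.eq_or_rank_lt h
  · simpa using h
  obtain h' | h' := GraftCol.Rel.eq_or_rank_lt h'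
  · simpa using h'.symm
  · exact absurd (h x (by simp)) (h' y (by simp)).asymm

section graft

variable (a b s : ℕ)

/-- The lower vertex of the tree with two vertices. -/
def graftLower : (graftRel.{u} a b s).operad.Op := (graftRel a b s).op .lower

/-- The upper vertex of the tree with two vertices. -/
def graftUpper : (graftRel.{u} a b s).operad.Op := (graftRel a b s).op .upper

/-- The composite of the two vertices of the tree with two vertices. -/
def graftWhole : (graftRel.{u} a b s).operad.Op := (graftRel a b s).op .whole

theorem graftLower_inputs : (graftRel.{u} a b s).operad.inputs (graftLower a b s) =
    GraftCol.lefts a b s ++ .mid :: GraftCol.rights a b s := rfl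

theorem graftUpper_inputs : (graftRel.{u} a b s).operad.inputs (graftUpper a b s) =
    GraftCol.inners a b s := rfl

theorem graftWhole_inputs : (graftRel.{u} a b s).operad.inputs (graftWhole a b s) =
    GraftCol.lefts a b s ++ GraftCol.inners a b s ++ GraftCol.rights a b s := rfl

theorem graftRel_cases (x : (graftRel.{u} a b s).operad.Op) :
    (∃ c, x = (graftRel a b s).operad.one c) ∨ x = graftLower a b s ∨ x = graftUpper a b s ∨
      x = graftWhole a b s := by
  obtain ⟨⟨l, c⟩, h⟩ := x
  have h' : GraftCol.Rel l c := h
  cases h' with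
  | one => exact Or.inl ⟨c, rfl⟩
  | lower => exact Or.inr (Or.inl rfl)
  | upper => exact Or.inr (Or.inr (Or.inl rfl))
  | whole => exact Or.inr (Or.inr (Or.inr rfl))

theorem graftRel_eq_one {a b s : ℕ} {x : (graftRel.{u} a b s).operad.Op}
    (h : ((graftRel.{u} a b s).operad.output x).rank = 0) :
    x = (graftRel a b s).operad.one ((graftRel a b s).operad.output x) :=
  ThinRel.op_ext (GraftCol.Rel.eq_of_rank x.2 h) rfl

theorem graftRel_eq_map_one {a b s : ℕ} (qs : List (graftRel.{u} a b s).operad.Op)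
    (l : List (GraftCol.{u} a b s)) (h : qs.map (graftRel.{u} a b s).operad.output = l)
    (hl : ∀ c ∈ l, c.rank = 0) : qs = l.map (graftRel a b s).operad.one := by
  subst h
  refine Eq.trans ?_ (List.map_map).symm
  exact (List.map_id qs).symm.trans
    (List.map_congr_left fun q hq => graftRel_eq_one (hl _ (List.mem_map_of_mem hq)))

theorem graftWhole_eq : graftWhole.{u} a b s =
    (graftRel a b s).operad.insertOp (graftLower a b s) (graftUpper a b s)
      (GraftCol.lefts a b s) (GraftCol.rights a b s) rfl :=
  ThinRel.op_ext ((graftRel a b s).operad.inputs_insertOp (graftLower a b s) (graftUpper a b s)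
      (GraftCol.lefts a b s) (GraftCol.rights a b s) rfl).symm
    ((graftRel a b s).operad.output_insertOp (graftLower a b s) (graftUpper a b s)
      (GraftCol.lefts a b s) (GraftCol.rights a b s) rfl).symm

theorem graftRel_split {qs : List (graftRel.{u} a b s).operad.Op}
    (h : qs.map (graftRel a b s).operad.output =
      (graftRel a b s).operad.inputs (graftLower a b s)) :
    ∃ y, qs = (GraftCol.lefts a b s).map (graftRel a b s).operad.one ++
        y :: (GraftCol.rights a b s).map (graftRel a b s).operad.one ∧
      (graftRel a b s).operad.output y = GraftCol.mid := by
  have h' : List.map (fun y : (graftRel a b s).operad.Op => y.1.2) qs =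
    GraftCol.lefts a b s ++ GraftCol.mid :: GraftCol.rights a b s := h
  rw [List.map_eq_append_iff] at h'
  obtain ⟨qs₁, qs₂, rfl, e₁, e₂⟩ := h'
  rw [List.map_eq_cons_iff] at e₂
  obtain ⟨y, qs₂, rfl, e₂, e₃⟩ := e₂
  refine ⟨y, ?_, e₂⟩
  rw [← graftRel_eq_map_one qs₁ _ e₁ fun c hc => GraftCol.rank_of_mem_lefts hc,
    ← graftRel_eq_map_one qs₂ _ e₃ fun c hc => GraftCol.rank_of_mem_rights hc]

theorem one_ne_graftLower (c) : (graftRel.{u} a b s).operad.one c ≠ graftLower a b s := by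
  intro h
  have h' := ThinRel.eq_one_iff.1 ⟨c, h.symm⟩
  have : GraftCol.mid ∈ [GraftCol.root (a := a) (b := b) (s := s)] := by
    rw [← show _ = [GraftCol.root] from h', graftLower_inputs]
    simp
  simp at this

theorem one_ne_graftUpper (c) : (graftRel.{u} a b s).operad.one c ≠ graftUpper a b s := by
  intro h
  have h' := ThinRel.eq_one_iff.1 ⟨c, h.symm⟩
  have : GraftCol.mid ∈ GraftCol.inners a b s := by
    rw [← graftUpper_inputs, h']
    exact List.mem_singleton_self _
  simpa [GraftCol.rank] using GraftCol.rank_of_mem_inners this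

theorem root_notMem_graftWhole : GraftCol.root ∉
    GraftCol.lefts.{u} a b s ++ GraftCol.inners a b s ++ GraftCol.rights a b s := by
  simp [GraftCol.lefts, GraftCol.inners, GraftCol.rights]

theorem one_ne_graftWhole (c) : (graftRel.{u} a b s).operad.one c ≠ graftWhole a b s := by
  intro h
  have h' := ThinRel.eq_one_iff.1 ⟨c, h.symm⟩
  refine root_notMem_graftWhole a b s ?_
  rw [← graftWhole_inputs, h']
  exact List.mem_singleton_self _

theorem graftUpper_ne_graftLower : graftUpper.{u} a b s ≠ graftLower a b s := by
  intro h
  have h' := congrArg (graftRel.{u} a b s).operad.output h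
  exact absurd h' (by change GraftCol.mid ≠ GraftCol.root; simp)

theorem graftWhole_ne_graftUpper : graftWhole.{u} a b s ≠ graftUpper a b s := by
  intro h
  have h' := congrArg (graftRel.{u} a b s).operad.output h
  exact absurd h' (by change GraftCol.root ≠ GraftCol.mid; simp)

theorem graftWhole_ne_graftLower : graftWhole.{u} a b s ≠ graftLower a b s := by
  intro h
  have h' := congrArg (graftRel.{u} a b s).operad.inputs h
  have : GraftCol.mid ∈ (graftRel.{u} a b s).operad.inputs (graftWhole a b s) := by
    rw [h', graftLower_inputs]
    exact List.mem_append_right _ List.mem_cons_self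
  have h₁ : GraftCol.mid ∉
      GraftCol.lefts.{u} a b s ++ GraftCol.inners a b s ++ GraftCol.rights a b s := by
    simp [GraftCol.lefts, GraftCol.inners, GraftCol.rights]
  exact h₁ this

end graft

section graftHom

variable (P : NSOperad.{u}) (p q : P.Op) (l r : List P.Col)

/-- The colours of two composable operations. -/
def graftPort : GraftCol.{u} l.length r.length (P.inputs q).length → P.Col
  | .left i => l[i]
  | .right i => r[i]
  | .inner i => (P.inputs q)[i]
  | .mid => P.output q
  | .root => P.output p

theorem map_graftPort_lefts : (GraftCol.lefts _ _ _).map (P.graftPort p q l r) = l := by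
  simp only [GraftCol.lefts, List.map_map]
  exact List.map_getElem_finRange _

theorem map_graftPort_rights : (GraftCol.rights _ _ _).map (P.graftPort p q l r) = r := by
  simp only [GraftCol.rights, List.map_map]
  exact List.map_getElem_finRange _

theorem map_graftPort_inners :
    (GraftCol.inners _ _ _).map (P.graftPort p q l r) = P.inputs q := by
  simp only [GraftCol.inners, List.map_map]
  exact List.map_getElem_finRange _

theorem map_graftPort_whole :
    (GraftCol.lefts _ _ _ ++ GraftCol.inners _ _ _ ++ GraftCol.rights _ _ _).map
      (P.graftPort p q l r) = l ++ P.inputs q ++ r := by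
  rw [List.map_append, List.map_append, map_graftPort_lefts, map_graftPort_inners,
    map_graftPort_rights]

variable (h : P.inputs p = l ++ P.output q :: r)

open Classical in
/-- The map on operations associated with two composable operations. -/
noncomputable def graftOp (x : (graftRel.{u} l.length r.length (P.inputs q).length).operad.Op) :
    P.Op :=
  if x = graftLower _ _ _ then p else if x = graftUpper _ _ _ then q
    else if x = graftWhole _ _ _ then P.insertOp p q l r h
    else P.one (P.graftPort p q l r x.1.2)

theorem graftOp_lower : P.graftOp p q l r h (graftLower _ _ _) = p := if_pos rfl

theorem graftOp_upper : P.graftOp p q l r h (graftUpper _ _ _) = q := by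
  rw [graftOp, if_neg (graftUpper_ne_graftLower _ _ _), if_pos rfl]

theorem graftOp_whole : P.graftOp p q l r h (graftWhole _ _ _) = P.insertOp p q l r h := by
  rw [graftOp, if_neg (graftWhole_ne_graftLower _ _ _), if_neg (graftWhole_ne_graftUpper _ _ _),
    if_pos rfl]

theorem graftOp_one (c : GraftCol l.length r.length (P.inputs q).length) :
    P.graftOp p q l r h ((graftRel _ _ _).operad.one c) =
    P.one (P.graftPort p q l r c) := by
  rw [graftOp, if_neg (one_ne_graftLower _ _ _ c), if_neg (one_ne_graftUpper _ _ _ c),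
    if_neg (one_ne_graftWhole _ _ _ c)]
  rfl

theorem map_graftOp_map_one (L : List (GraftCol l.length r.length (P.inputs q).length)) :
    (List.map (graftRel _ _ _).operad.one L).map (P.graftOp p q l r h) =
      (L.map (P.graftPort p q l r)).map P.one := by
  induction L with
  | nil => rfl
  | cons c L ih => exact congrArg₂ List.cons (P.graftOp_one p q l r h c) ih

/-- The morphism from the tree with two vertices given by two composable operations. -/
noncomputable def graftHom :
    (graftRel.{u} l.length r.length (P.inputs q).length).operad ⟶ P :=
  homOfNontrivial (P.graftPort p q l r) (P.graftOp p q l r h)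
    (fun x => by
      obtain ⟨c, rfl⟩ | rfl | rfl | rfl := graftRel_cases _ _ _ x
      · exact (congrArg P.inputs (P.graftOp_one p q l r h c)).trans (P.inputs_one _)
      · rw [graftOp_lower, h]
        refine Eq.trans ?_ (List.map_append (l₁ := GraftCol.lefts _ _ _)).symm
        rw [map_graftPort_lefts]
        exact congrArg (fun r' => l ++ P.output q :: r') (P.map_graftPort_rights p q l r).symm
      · rw [graftOp_upper]
        exact (P.map_graftPort_inners p q l r).symm
      · rw [graftOp_whole, P.inputs_insertOp]
        exact (P.map_graftPort_whole p q l r).symm)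
    (fun x => by
      obtain ⟨c, rfl⟩ | rfl | rfl | rfl := graftRel_cases _ _ _ x
      · exact (congrArg P.output (P.graftOp_one p q l r h c)).trans (P.output_one _)
      · rw [graftOp_lower]
        rfl
      · rw [graftOp_upper]
        rfl
      · rw [graftOp_whole, P.output_insertOp]
        rfl)
    (fun c => P.graftOp_one p q l r h c)
    -- The only nontrivial composite in the tree plugs the upper vertex into the inner edge of the
    -- lower one; it is sent to the partial composite by construction.
    (fun x qs hx hx' h₁ hq => by
      obtain ⟨c, rfl⟩ | rfl | rfl | rfl := graftRel_cases _ _ _ x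
      · exact absurd rfl (h₁ c)
      · obtain ⟨y, rfl, e⟩ := graftRel_split _ _ _ hx
        obtain ⟨c, rfl⟩ | rfl | rfl | rfl := graftRel_cases _ _ _ y
        · obtain rfl : c = GraftCol.mid := e
          exact absurd (List.map_append (f := (graftRel _ _ _).operad.one)
            (l₁ := GraftCol.lefts _ _ _) (l₂ := GraftCol.mid :: GraftCol.rights _ _ _)).symm hq
        · exact absurd e (by change GraftCol.root ≠ GraftCol.mid; simp)
        · refine Eq.trans (congrArg (P.graftOp p q l r h) (graftWhole_eq _ _ _).symm)
            ((P.graftOp_whole p q l r h).trans (P.comp_congr ?_ ?_ _ _))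
          · rw [graftOp_lower]
          · rw [List.map_append, List.map_cons, graftOp_upper]
            exact (congrArg₂ (fun l' r' => l' ++ q :: r')
              ((P.map_graftOp_map_one p q l r h _).trans
                (congrArg _ (P.map_graftPort_lefts p q l r)))
              ((P.map_graftOp_map_one p q l r h _).trans
                (congrArg _ (P.map_graftPort_rights p q l r)))).symm
        · exact absurd e (by change GraftCol.root ≠ GraftCol.mid; simp)
      · exact absurd (graftRel_eq_map_one qs _ hx fun c hc => GraftCol.rank_of_mem_inners hc) hq
      · exact absurd (graftRel_eq_map_one qs _ hx fun c hc => GraftCol.rank_of_mem_whole hc) hq)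

end graftHom

end NSOperad

/-! ### Two separating operads, and natural bijections on colours and operations -/

namespace NSOperad

/-- The two colours of an operad in which every list of colours is the list of inputs of a unique
operation with output `any`, and in which only the identity has output `rigid`. -/
inductive AnyCol : Type u
  | rigid : AnyCol
  | any : AnyCol

/-- The operad on two colours with a unique operation from every list of colours to `any`, and only
the identity with output `rigid`. -/
def anyRel : ThinRel AnyCol.{u} where
  rel l c := c = .any ∨ l = [c]
  refl _ := Or.inr rfl
  trans L c hL h := by
    obtain h | h := h
    · exact Or.inl h
    · rw [List.map_eq_singleton_iff] at h
      obtain ⟨x, rfl, rfl⟩ := h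
      simpa using hL x (by simp)

theorem anyRel_rigid : Rigid anyRel.{u}.operad := by
  refine ThinRel.rigid fun x y h h' => ?_
  obtain rfl | h := h
  · obtain rfl | h' := h'
    · rfl
    · exact (List.head_eq_of_cons_eq h').symm
  · exact List.head_eq_of_cons_eq h

/-- The colours of an operad that has a single binary operation, with inputs `fst`, `snd` and output
`out`, up to the insertion of any number of inputs of colour `fill`. -/
inductive PairCol : Type u
  | fst : PairCol
  | snd : PairCol
  | fill : PairCol
  | out : PairCol

namespace PairCol

/-- Whether a colour is not `fill`. -/
def visible : PairCol.{u} → Bool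
  | fill => false
  | _ => true

/-- The operations of an operad that has a single binary operation up to the insertion of any
number of inputs of colour `fill`. -/
inductive Rel : List PairCol.{u} → PairCol.{u} → Prop
  | one (c) : Rel [c] c
  | fill (l) (h : l.filter visible = []) : Rel l fill
  | out (l) (h : l.filter visible = [fst, snd]) : Rel l out

/-- Identities and operations with output `fill` have the same visible part on both sides. Only a
non-identity operation with output `out` can change it, replacing `out` by `fst`, `snd`. -/
theorem filter_flatMap (L : List (List PairCol.{u} × PairCol.{u})) (hL : ∀ x ∈ L, Rel x.1 x.2)
    (h : out ∉ L.map Prod.snd) :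
    (L.flatMap Prod.fst).filter visible = (L.map Prod.snd).filter visible := by
  induction L with
  | nil => rfl
  | cons x L ih =>
    rw [List.map_cons, List.mem_cons, not_or] at h
    rw [List.flatMap_cons, List.filter_append, ih (fun y hy => hL y (by simp [hy])) h.2,
      List.map_cons, ← List.singleton_append, List.filter_append]
    congr 1
    have hx := hL x (by simp)
    have hx' := h.1
    generalize x.1 = l, x.2 = c at hx hx' ⊢
    cases hx with
    | one => rfl
    | fill _ h => exact h
    | out _ _ => exact absurd rfl hx'

/-- The two visible inputs already occupy both places, so there is no room for `fill`. -/
theorem Rel.eq_pair {l : List PairCol.{u}} (h : Rel l PairCol.out) (hl : l.length = 2) :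
    l = [fst, snd] := by
  cases h with
  | one => simp at hl
  | out _ h =>
    rw [← h]
    refine (List.filter_sublist.eq_of_length ?_).symm
    rw [h, hl]
    rfl

end PairCol

open PairCol in
/-- The operad that has a single binary operation up to the insertion of any number of inputs of
colour `fill`. -/
def pairRel : ThinRel PairCol.{u} where
  rel := Rel
  refl := Rel.one
  trans L c hL h := by
    generalize hl : L.map Prod.snd = l at h
    cases h with
    | one =>
      rw [List.map_eq_singleton_iff] at hl
      obtain ⟨x, rfl, rfl⟩ := hl
      simpa using hL x (by simp)
    | fill _ h =>
      refine Rel.fill _ ?_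
      rw [filter_flatMap L hL, hl, h]
      intro hmem
      have : out ∈ l.filter visible := List.mem_filter.2 ⟨hl ▸ hmem, rfl⟩
      simp [h] at this
    | out _ h =>
      refine Rel.out _ ?_
      rw [filter_flatMap L hL, hl, h]
      intro hmem
      have : out ∈ l.filter visible := List.mem_filter.2 ⟨hl ▸ hmem, rfl⟩
      simp [h] at this

open PairCol in
theorem pairRel_rigid : Rigid pairRel.{u}.operad := by
  have H : ∀ x y, Rel [x] y → x = y := by
    intro x y h
    generalize hl : [x] = l at h
    cases h with
    | one => exact List.head_eq_of_cons_eq hl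
    | fill _ h =>
      subst hl
      cases x <;> simp [visible] at h ⊢
    | out _ h =>
      have := congrArg List.length h
      have h' := List.length_filter_le visible l
      rw [← hl] at this h'
      simp at this h'
      omega
  exact ThinRel.rigid fun x y h _ => H x y h

theorem filter_eq_pair {α : Type*} [DecidableEq α] {l : List α} (hl : l.Nodup) {i j : α}
    (h : List.Sublist [i, j] l) :
    l.filter (fun k => decide (k = i ∨ k = j)) = [i, j] := by
  have h₁ : List.Sublist [i, j] (l.filter (fun k => decide (k = i ∨ k = j))) := by
    have := h.filter (fun k => decide (k = i ∨ k = j))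
    simpa using this
  refine (h₁.eq_of_length_le ?_).symm
  refine (List.subperm_of_subset (hl.filter _) fun k hk => ?_).length_le
  simpa using (List.mem_filter.1 hk).2

theorem pair_sublist_finRange {n : ℕ} {i j : Fin n} (h : i < j) :
    List.Sublist [i, j] (List.finRange n) := by
  refine List.sublist_of_subperm_of_sortedLE (List.subperm_of_subset ?_ fun k _ => ?_) ?_ ?_
  · simp [h.ne]
  · exact List.mem_finRange k
  · simp [List.sortedLE_iff_pairwise, h.le]
  · exact (List.pairwise_le_finRange n).sortedLE

section

variable {𝒬 : ObjectProperty NSOperad.{u}} [Admissible 𝒬]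

/-- Natural bijections between the colours and the operations of `X` and those of `F X` that
preserve arities and identities, but do not necessarily preserve inputs, outputs and
composition. -/
structure Transfer (F : 𝒬.FullSubcategory ⥤ 𝒬.FullSubcategory) where
  col : ∀ X, X.obj.Col ≃ (F.obj X).obj.Col
  op : ∀ X, X.obj.Op ≃ (F.obj X).obj.Op
  col_map : ∀ {X Y} (f : X ⟶ Y) (c), colMap (F.map f) (col X c) = col Y (colMap f c)
  op_map : ∀ {X Y} (f : X ⟶ Y) (p), opMap (F.map f) (op X p) = op Y (opMap f p)
  length_inputs : ∀ X p, ((F.obj X).obj.inputs (op X p)).length = (X.obj.inputs p).length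
  op_one : ∀ X c, ∃ d, op X (X.obj.one c) = (F.obj X).obj.one d
  nodup_top : ∀ n, ((F.obj (cor 𝒬 n)).obj.output (op _ (top n)) ::
    (F.obj (cor 𝒬 n)).obj.inputs (op _ (top n))).Nodup

namespace Transfer

variable {F : 𝒬.FullSubcategory ⥤ 𝒬.FullSubcategory} (t : Transfer F)

/-- The port of a corolla that corresponds to the output. -/
def rootPort (n : ℕ) : CorCol.{u} n :=
  (t.col (cor 𝒬 n)).symm ((F.obj (cor 𝒬 n)).obj.output (t.op _ (top n)))

/-- The ports of a corolla that correspond to the inputs. -/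
def leafPorts (n : ℕ) : List (CorCol.{u} n) :=
  ((F.obj (cor 𝒬 n)).obj.inputs (t.op _ (top n))).map (t.col (cor 𝒬 n)).symm

theorem op_eq (X : 𝒬.FullSubcategory) (p : X.obj.Op) {n : ℕ} (h : (X.obj.inputs p).length = n) :
    t.op X p = opMap (F.map (ofCor X p h)) (t.op _ (top n)) := by
  rw [t.op_map, opMap_ofCor]

/-- By naturality along the morphism classifying `p`, the effect on the ports of `p` is read off
from the corolla and depends only on the arity. -/
theorem colMap_map_ofCor (X : 𝒬.FullSubcategory) (p : X.obj.Op) {n : ℕ}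
    (h : (X.obj.inputs p).length = n) (d : (F.obj (cor 𝒬 n)).obj.Col) :
    colMap (F.map (ofCor X p h)) d = t.col X (X.obj.portCol p h ((t.col (cor 𝒬 n)).symm d)) := by
  obtain ⟨c, rfl⟩ := (t.col (cor 𝒬 n)).surjective d
  rw [t.col_map, Equiv.symm_apply_apply]
  rfl

theorem output_op_eq (X : 𝒬.FullSubcategory) (p : X.obj.Op) {n : ℕ}
    (h : (X.obj.inputs p).length = n) :
    (F.obj X).obj.output (t.op X p) = t.col X (X.obj.portCol p h (t.rootPort n)) := by
  rw [t.op_eq X p h, output_opMap]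
  exact t.colMap_map_ofCor X p h _

theorem inputs_op_eq (X : 𝒬.FullSubcategory) (p : X.obj.Op) {n : ℕ}
    (h : (X.obj.inputs p).length = n) :
    (F.obj X).obj.inputs (t.op X p) =
      (t.leafPorts n).map fun c => t.col X (X.obj.portCol p h c) := by
  rw [t.op_eq X p h, inputs_opMap]
  exact (List.map_congr_left fun c _ => t.colMap_map_ofCor X p h c).trans
    (List.map_map (f := (t.col (cor 𝒬 n)).symm)
      (g := fun c => t.col X (X.obj.portCol p h c))).symm

theorem nodup_ports (n : ℕ) : (t.rootPort n :: t.leafPorts n).Nodup :=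
  (t.nodup_top n).map (t.col (cor 𝒬 n)).symm.injective

theorem inputs_op_eq_nil {X : 𝒬.FullSubcategory} {p : X.obj.Op} (h : X.obj.inputs p = []) :
    (F.obj X).obj.inputs (t.op X p) = [] := by
  rw [← List.length_eq_zero_iff, t.length_inputs, h, List.length_nil]

theorem output_op_of_nil {X : 𝒬.FullSubcategory} {p : X.obj.Op} (h : X.obj.inputs p = []) :
    (F.obj X).obj.output (t.op X p) = t.col X (X.obj.output p) := by
  have h₀ : (X.obj.inputs p).length = 0 := by rw [h, List.length_nil]
  rw [t.output_op_eq X p h₀]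
  cases t.rootPort 0 with
  | root => rfl
  | leaf i => exact i.elim0

-- If some input became the output, a suitable operation of `anyRel`, with its remaining inputs
-- capped by nullary operations, would give a nullary operation with output the colour `rigid`,
-- which has none.
open Classical in
theorem rootPort_eq (n : ℕ) : t.rootPort n = CorCol.root := by
  cases hr : t.rootPort n with
  | root => rfl
  | leaf i =>
  exfalso
  let X : 𝒬.FullSubcategory := thin 𝒬 anyRel anyRel_rigid
  -- The input supposed to become the output is the only one coloured `rigid`. As ports are not
  -- repeated, all inputs of the transferred operation are then coloured `any`.
  let g (j : Fin n) : AnyCol.{u} := if j = i then .rigid else .any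
  let p : X.obj.Op := anyRel.op (l := (List.finRange n).map g) (c := .any) (Or.inl rfl)
  let r : X.obj.Op := anyRel.op (l := []) (c := .any) (Or.inl rfl)
  have hp : (X.obj.inputs p).length = n :=
    (List.length_map ..).trans List.length_finRange
  have hleaf (j : Fin n) : X.obj.portCol p hp (.leaf j) = g j := by
    change ((List.finRange n).map g)[j] = g j
    simp
  have hin : (F.obj X).obj.inputs (t.op X p) =
      (t.leafPorts n).map fun _ => t.col X AnyCol.any := by
    rw [t.inputs_op_eq X p hp]
    refine List.map_congr_left fun c hc => congrArg _ ?_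
    cases c with
    | root => rfl
    | leaf j =>
      refine (hleaf j).trans (if_neg ?_)
      rintro rfl
      exact (List.nodup_cons.1 (t.nodup_ports n)).1 (hr ▸ hc)
  have hout : (F.obj X).obj.output (t.op X p) = t.col X AnyCol.rigid := by
    rw [t.output_op_eq X p hp, hr]
    exact congrArg _ ((hleaf i).trans (if_pos rfl))
  have hr₀ := t.inputs_op_eq_nil (p := r) rfl
  have hr₁ : (F.obj X).obj.output (t.op X r) = t.col X AnyCol.any := t.output_op_of_nil rfl
  have hcomp : ((t.leafPorts n).map fun _ => t.op X r).map (F.obj X).obj.output =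
      (F.obj X).obj.inputs (t.op X p) := by
    rw [hin, List.map_map]
    exact List.map_congr_left fun _ _ => hr₁
  -- The composite is formed in `F X`, where composition is not yet understood, and pulled back to
  -- `X`; only its arity and output are needed.
  obtain ⟨s, hs⟩ := (t.op X).surjective ((F.obj X).obj.comp _ _ hcomp)
  have hs₀ : (F.obj X).obj.inputs (t.op X s) = [] := by
    rw [hs, (F.obj X).obj.inputs_comp, List.flatMap_map]
    simp [hr₀]
  have hs₁ : X.obj.inputs s = [] := by
    rw [← List.length_eq_zero_iff, ← t.length_inputs, hs₀, List.length_nil]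
  have hs₂ : X.obj.output s = AnyCol.rigid := by
    refine (t.col X).injective ?_
    rw [← t.output_op_of_nil hs₁, hs, (F.obj X).obj.output_comp, hout]
  obtain h | h := s.2
  · have := hs₂.symm.trans h
    simp at this
  · have := hs₁.symm.trans h
    simp at this

theorem output_op (X : 𝒬.FullSubcategory) (p : X.obj.Op) :
    (F.obj X).obj.output (t.op X p) = t.col X (X.obj.output p) := by
  rw [t.output_op_eq X p rfl, t.rootPort_eq]
  rfl

/-- The inputs of the operations of arity `n` are permuted. -/
theorem exists_inputs_op (n : ℕ) : ∃ σ : List (Fin n), σ.Nodup ∧ σ.Perm (List.finRange n) ∧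
    ∀ (X : 𝒬.FullSubcategory) (p : X.obj.Op) (h : (X.obj.inputs p).length = n),
      (F.obj X).obj.inputs (t.op X p) = σ.map fun i => t.col X (X.obj.inputs p)[i] := by
  have hn := List.nodup_cons.1 (t.nodup_ports n)
  rw [t.rootPort_eq] at hn
  have H : ∀ c ∈ t.leafPorts n, c ∈ Set.range (CorCol.leaf (n := n)) := by
    intro c hc
    cases c with
    | root => exact absurd hc hn.1
    | leaf i => exact ⟨i, rfl⟩
  have hex : ∃ σ : List (Fin n), σ.map CorCol.leaf = t.leafPorts n := by
    have : t.leafPorts n ∈ Set.range (List.map (CorCol.leaf (n := n))) := by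
      rw [Set.range_list_map]
      exact H
    exact this
  obtain ⟨σ, hσ⟩ := hex
  have hσ₁ : σ.Nodup := List.Nodup.of_map CorCol.leaf (hσ ▸ hn.2)
  have hσ₂ : σ.length = n := by
    rw [← List.length_map CorCol.leaf, hσ]
    exact (List.length_map _).trans ((t.length_inputs _ _).trans (length_inputs_top n))
  refine ⟨σ, hσ₁, ?_, fun X p h => ?_⟩
  · refine (List.subperm_of_subset hσ₁ fun i _ => List.mem_finRange i).perm_of_length_le ?_
    rw [List.length_finRange, hσ₂]
  · rw [t.inputs_op_eq X p h, ← hσ, List.map_map]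
    rfl

/-- The order of the inputs of binary operations is preserved. -/
def PreservesOrder : Prop :=
  ∀ (X : 𝒬.FullSubcategory) (p : X.obj.Op) (c d : X.obj.Col), X.obj.inputs p = [c, d] →
    (F.obj X).obj.inputs (t.op X p) = [t.col X c, t.col X d]

/-- The order of the inputs of binary operations is reversed. -/
def ReversesOrder : Prop :=
  ∀ (X : 𝒬.FullSubcategory) (p : X.obj.Op) (c d : X.obj.Col), X.obj.inputs p = [c, d] →
    (F.obj X).obj.inputs (t.op X p) = [t.col X d, t.col X c]

theorem preservesOrder_or_reversesOrder : t.PreservesOrder ∨ t.ReversesOrder := by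
  obtain ⟨σ, -, hσ, h⟩ := t.exists_inputs_op 2
  have : σ = [0, 1] ∨ σ = [1, 0] := by
    have : σ ∈ (List.finRange 2).permutations := List.mem_permutations.2 hσ
    revert this
    simp [List.finRange_succ, List.permutations, List.permutationsAux,
      List.permutationsAux.rec]
  obtain rfl | rfl := this
  · refine Or.inl fun X p c d hp => ?_
    rw [h X p (by simp [hp])]
    simp [hp]
  · refine Or.inr fun X p c d hp => ?_
    rw [h X p (by simp [hp])]
    simp [hp]

end Transfer

end

end NSOperad

/-! ### Preservation of input order and of composition -/

namespace NSOperad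

namespace Transfer

variable {𝒬 : ObjectProperty NSOperad.{u}} [Admissible 𝒬]
  {F : 𝒬.FullSubcategory ⥤ 𝒬.FullSubcategory} (t : Transfer F)

open Classical in
/-- If `t` preserves the order of the inputs of binary operations, then two inputs of an operation
cannot be swapped. -/
theorem not_sublist_of_lt (ht : t.PreservesOrder) {n : ℕ} {σ : List (Fin n)} (hσ : σ.Nodup)
    (h : ∀ (X : 𝒬.FullSubcategory) (p : X.obj.Op) (h : (X.obj.inputs p).length = n),
      (F.obj X).obj.inputs (t.op X p) = σ.map fun i => t.col X (X.obj.inputs p)[i])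
    {i j : Fin n} (hij : i < j) : ¬ List.Sublist [j, i] σ := by
  intro hs
  let X : 𝒬.FullSubcategory := thin 𝒬 pairRel pairRel_rigid
  -- All inputs except `i` and `j` are made erasable. As `i < j`, the visible inputs are `fst`,
  -- `snd` in this order, as required by `pairRel`.
  let g (k : Fin n) : PairCol.{u} := if k = i then .fst else if k = j then .snd else .fill
  have hvis (k : Fin n) : (g k).visible = decide (k = i ∨ k = j) := by
    by_cases h₁ : k = i
    · simp [g, h₁, PairCol.visible]
    · by_cases h₂ : k = j
      · rw [show g k = .snd from (if_neg h₁).trans (if_pos h₂)]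
        simp [h₂, PairCol.visible]
      · simp [g, h₁, h₂, PairCol.visible]
  have hgi : g i = .fst := if_pos rfl
  have hgj : g j = .snd := by simp [g, hij.ne']
  have hfilter (l : List (Fin n)) : (l.map g).filter PairCol.visible =
      (l.filter fun k => decide (k = i ∨ k = j)).map g := by
    rw [List.filter_map]
    congr 2
    exact funext hvis
  let p : X.obj.Op := pairRel.op (l := (List.finRange n).map g) (c := .out) (.out _ (by
    rw [hfilter, filter_eq_pair (List.nodup_finRange n) (pair_sublist_finRange hij)]
    simp [hgi, hgj]))
  let r : X.obj.Op := pairRel.op (l := []) (c := .fill) (.fill _ rfl)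
  have hp : (F.obj X).obj.inputs (t.op X p) = σ.map fun k => t.col X (g k) := by
    rw [h X p ((List.length_map ..).trans List.length_finRange)]
    refine List.map_congr_left fun k _ => congrArg _ ?_
    change ((List.finRange n).map g)[k] = g k
    simp
  let q (c : PairCol.{u}) : (F.obj X).obj.Op :=
    if c.visible then (F.obj X).obj.one (t.col X c) else t.op X r
  have hq₁ (c : PairCol.{u}) : (F.obj X).obj.output (q c) = t.col X c := by
    by_cases hc : c.visible
    · rw [show q c = _ from if_pos hc, (F.obj X).obj.output_one]
    · rw [show q c = _ from if_neg hc, t.output_op]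
      cases c with
      | fill => rfl
      | _ => exact absurd rfl hc
  have hq₂ (c : PairCol.{u}) : (F.obj X).obj.inputs (q c) =
      if c.visible then [t.col X c] else [] := by
    by_cases hc : c.visible
    · rw [show q c = _ from if_pos hc, (F.obj X).obj.inputs_one, if_pos hc]
    · rw [show q c = _ from if_neg hc, t.inputs_op_eq_nil (p := r) rfl, if_neg hc]
  have hq₃ (l : List PairCol.{u}) : (l.map q).flatMap (F.obj X).obj.inputs =
      (l.filter PairCol.visible).map (t.col X) := by
    induction l with
    | nil => rfl
    | cons c l ih =>
      rw [List.map_cons, List.flatMap_cons, ih, hq₂, List.filter_cons]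
      split <;> rfl
  have hcomp : ((σ.map g).map q).map (F.obj X).obj.output =
      (F.obj X).obj.inputs (t.op X p) := by
    rw [hp, List.map_map, List.map_map]
    exact List.map_congr_left fun _ _ => hq₁ _
  -- Erasing in `F X` leaves a binary operation whose inputs correspond to `snd`, `fst`. Its
  -- preimage `s` is binary with output `out`, so has inputs `fst`, `snd`, contradicting
  -- preservation of order in arity 2.
  obtain ⟨s, hs'⟩ := (t.op X).surjective ((F.obj X).obj.comp _ _ hcomp)
  have hs₀ : (F.obj X).obj.inputs (t.op X s) = [t.col X PairCol.snd, t.col X PairCol.fst] := by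
    rw [hs', (F.obj X).obj.inputs_comp, hq₃, hfilter]
    have := filter_eq_pair hσ hs
    simp only [or_comm (a := _ = j)] at this
    rw [this, List.map_cons, List.map_cons, hgi, hgj]
    rfl
  have hs₁ : X.obj.output s = PairCol.out := by
    refine (t.col X).injective ?_
    rw [← t.output_op, hs', (F.obj X).obj.output_comp, t.output_op]
    rfl
  have hs₂ : (X.obj.inputs s).length = 2 := by
    rw [← t.length_inputs, hs₀]
    rfl
  have key : X.obj.inputs s = [PairCol.fst, PairCol.snd] := by
    have hrel : PairCol.Rel (X.obj.inputs s) (X.obj.output s) := s.2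
    rw [hs₁] at hrel
    exact hrel.eq_pair hs₂
  have h₁ := ht X s PairCol.fst PairCol.snd key
  rw [hs₀] at h₁
  have := (t.col X).injective (List.head_eq_of_cons_eq h₁)
  simp at this

theorem inputs_op (ht : t.PreservesOrder) (X : 𝒬.FullSubcategory) (p : X.obj.Op) :
    (F.obj X).obj.inputs (t.op X p) = (X.obj.inputs p).map (t.col X) := by
  obtain ⟨σ, hσ, hperm, h⟩ := t.exists_inputs_op (X.obj.inputs p).length
  have hpair : σ.Pairwise (· ≤ ·) := by
    rw [List.pairwise_iff_forall_sublist]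
    intro j i hs
    by_contra hij
    exact t.not_sublist_of_lt ht hσ h (not_le.1 hij) hs
  obtain rfl : σ = List.finRange _ := hperm.eq_of_pairwise' hpair (List.pairwise_le_finRange _)
  rw [h X p rfl]
  conv_rhs => rw [← List.map_getElem_finRange (X.obj.inputs p), List.map_map]
  rfl

theorem op_one_eq (X : 𝒬.FullSubcategory) (c : X.obj.Col) :
    t.op X (X.obj.one c) = (F.obj X).obj.one (t.col X c) := by
  rw [(F.obj X).obj.eq_of_one (t.op_one X c), t.output_op, X.obj.output_one]

/-- The operad of a tree with two vertices, as an object of a class of operads that contains the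
rigid ones. -/
abbrev graft (𝒬 : ObjectProperty NSOperad.{u}) [Admissible 𝒬] (a b s : ℕ) :
    𝒬.FullSubcategory := thin 𝒬 (graftRel a b s) (graftRel_rigid a b s)

theorem insertable_op (ht : t.PreservesOrder) {X : 𝒬.FullSubcategory} {p q : X.obj.Op}
    {l r : List X.obj.Col} (h : X.obj.inputs p = l ++ X.obj.output q :: r) :
    (F.obj X).obj.inputs (t.op X p) =
      l.map (t.col X) ++ (F.obj X).obj.output (t.op X q) :: r.map (t.col X) :=
  insertable_map (t.inputs_op ht X) (t.output_op X) h

/-- The partial composite in the image of the tree comes from some operation `x` of the tree. Inputs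
and output are preserved and colours correspond bijectively, so `x` has the inputs and output of
`graftWhole`; as the tree is thin, they agree. -/
theorem op_graftWhole (ht : t.PreservesOrder) (a b s : ℕ) :
    t.op (graft 𝒬 a b s) (graftWhole a b s) =
      (F.obj (graft 𝒬 a b s)).obj.insertOp (t.op (graft 𝒬 a b s) (graftLower a b s))
        (t.op (graft 𝒬 a b s) (graftUpper a b s))
        ((GraftCol.lefts a b s).map (t.col (graft 𝒬 a b s)))
        ((GraftCol.rights a b s).map (t.col (graft 𝒬 a b s)))
        (t.insertable_op ht (X := graft 𝒬 a b s) (p := graftLower a b s) (q := graftUpper a b s)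
          (l := GraftCol.lefts a b s) (r := GraftCol.rights a b s) rfl) := by
  obtain ⟨x, hx⟩ := (t.op (graft 𝒬 a b s)).surjective
    ((F.obj (graft 𝒬 a b s)).obj.insertOp _ _ _ _
      (t.insertable_op ht (X := graft 𝒬 a b s) (p := graftLower a b s) (q := graftUpper a b s)
        (l := GraftCol.lefts a b s) (r := GraftCol.rights a b s) rfl))
  rw [← hx]
  refine congrArg _ (ThinRel.op_ext (T := graftRel a b s) ?_ ?_)
  · refine (List.map_injective_iff.2 (t.col (graft 𝒬 a b s)).injective) ?_
    refine Eq.trans ?_ (t.inputs_op ht _ x)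
    rw [hx, inputs_insertOp]
    refine Eq.trans ?_ (congrArg (fun z => _ ++ z ++ _)
      (t.inputs_op ht (graft 𝒬 a b s) (graftUpper a b s)).symm)
    exact (List.map_append (f := t.col (graft 𝒬 a b s))
      (l₁ := GraftCol.lefts a b s ++ GraftCol.inners a b s)).trans
      (congrArg (· ++ _) (List.map_append (f := t.col (graft 𝒬 a b s))))
  · refine (t.col (graft 𝒬 a b s)).injective (Eq.trans ?_ (t.output_op _ x))
    rw [hx, output_insertOp]
    exact (t.output_op (graft 𝒬 a b s) (graftLower a b s)).symm

/-- The universal case `op_graftWhole` is carried to `X` by naturality along the morphism from the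
tree that classifies `p` and `q`. -/
theorem op_insertOp (ht : t.PreservesOrder) (X : 𝒬.FullSubcategory) (p q : X.obj.Op)
    (l r : List X.obj.Col) (h : X.obj.inputs p = l ++ X.obj.output q :: r) :
    t.op X (X.obj.insertOp p q l r h) =
      (F.obj X).obj.insertOp (t.op X p) (t.op X q) (l.map (t.col X)) (r.map (t.col X))
        (t.insertable_op ht h) := by
  let f : graft 𝒬 l.length r.length (X.obj.inputs q).length ⟶ X :=
    ObjectProperty.homMk (X.obj.graftHom p q l r h)
  have h₁ : opMap f (graftLower _ _ _) = p := X.obj.graftOp_lower p q l r h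
  have h₂ : opMap f (graftUpper _ _ _) = q := X.obj.graftOp_upper p q l r h
  have h₃ : opMap f (graftWhole _ _ _) = X.obj.insertOp p q l r h :=
    X.obj.graftOp_whole p q l r h
  have hl : List.map (colMap f) (GraftCol.lefts _ _ _) = l := X.obj.map_graftPort_lefts p q l r
  have hr : List.map (colMap f) (GraftCol.rights _ _ _) = r := X.obj.map_graftPort_rights p q l r
  have hcol (L : List (graft 𝒬 l.length r.length (X.obj.inputs q).length).obj.Col) :
      (L.map (t.col _)).map (Hom.onCol (F.map f).hom) = (L.map (colMap f)).map (t.col X) := by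
    rw [List.map_map, List.map_map]
    exact List.map_congr_left fun c _ => t.col_map f c
  refine (congrArg (t.op X) h₃).symm.trans ((t.op_map f _).symm.trans
    ((congrArg (opMap (F.map f)) (t.op_graftWhole ht _ _ _)).trans ?_))
  refine (onOp_insertOp (F.map f).hom _ _ _ _ _).trans ?_
  refine NSOperad.insertOp_congr _ ?_ ?_ ?_ ?_ _ _
  · exact (t.op_map f _).trans (congrArg _ h₁)
  · exact (t.op_map f _).trans (congrArg _ h₂)
  · exact (hcol _).trans (congrArg _ hl)
  · exact (hcol _).trans (congrArg _ hr)

/-- The morphism `X ⟶ F X` given by the bijections on colours and operations. -/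
def hom (ht : t.PreservesOrder) (X : 𝒬.FullSubcategory) : X ⟶ F.obj X :=
  ObjectProperty.homMk (homOfInsert (t.col X) (t.op X) (t.inputs_op ht X) (t.output_op X)
    (t.op_one_eq X) (t.op_insertOp ht X))

theorem isIso_hom (ht : t.PreservesOrder) (X : 𝒬.FullSubcategory) : IsIso (t.hom ht X) := by
  rw [← ObjectProperty.isIso_hom_iff]
  exact isIso_of_bijective _ (t.col X).bijective (t.op X).bijective

theorem nonempty_iso_id (ht : t.PreservesOrder) : Nonempty (F ≅ 𝟭 _) := by
  have hiso := t.isIso_hom ht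
  let e : 𝟭 _ ≅ F := NatIso.ofComponents (fun X => @asIso _ _ _ _ (t.hom ht X) (hiso X))
    fun f => full_hom_ext (fun c => (t.col_map f c).symm) fun p => (t.op_map f p).symm
  exact ⟨e.symm⟩

/-- Composition with the mirror functor. -/
def mirrorComp : Transfer (F ⋙ mirrorFull 𝒬) where
  col := t.col
  op := t.op
  col_map := t.col_map
  op_map := t.op_map
  length_inputs X p := (List.length_reverse ..).trans (t.length_inputs X p)
  op_one := t.op_one
  nodup_top n := by
    have := t.nodup_top n
    rw [List.nodup_cons] at this
    exact List.nodup_cons.2 ⟨fun h => this.1 (List.mem_reverse.1 h), List.nodup_reverse.2 this.2⟩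

theorem preservesOrder_mirrorComp (ht : t.ReversesOrder) : t.mirrorComp.PreservesOrder :=
  fun X p c d h => congrArg List.reverse (ht X p c d h)

end Transfer

/-- The canonical morphism from an operad to the mirror of its mirror. -/
def toMirrorMirror (P : NSOperad.{u}) : P ⟶ P.mirrorObj.mirrorObj :=
  Hom.mk id id (fun _ => (List.reverse_reverse _).trans (List.map_id _).symm) (fun _ => rfl)
    (fun _ => rfl)
    (fun _ _ _ _ => P.comp_congr rfl ((List.reverse_reverse _).trans (List.map_id _)).symm _ _)

variable (𝒬 : ObjectProperty NSOperad.{u}) [Admissible 𝒬]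

theorem nonempty_mirrorFull_comp_mirrorFull :
    Nonempty (mirrorFull 𝒬 ⋙ mirrorFull 𝒬 ≅ 𝟭 _) := by
  let f (X : 𝒬.FullSubcategory) : X ⟶ (mirrorFull 𝒬 ⋙ mirrorFull 𝒬).obj X :=
    ObjectProperty.homMk (toMirrorMirror X.obj)
  have hf (X : 𝒬.FullSubcategory) : IsIso (f X) := by
    rw [← ObjectProperty.isIso_hom_iff]
    exact isIso_of_bijective _ Function.bijective_id Function.bijective_id
  let e : 𝟭 _ ≅ mirrorFull 𝒬 ⋙ mirrorFull 𝒬 :=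
    NatIso.ofComponents (fun X => @asIso _ _ _ _ (f X) (hf X)) fun _ => rfl
  exact ⟨e.symm⟩

variable {𝒬} in
theorem Transfer.nonempty_iso {F : 𝒬.FullSubcategory ⥤ 𝒬.FullSubcategory} (t : Transfer F) :
    Nonempty (F ≅ 𝟭 _) ∨ Nonempty (F ≅ mirrorFull 𝒬) := by
  obtain ht | ht := t.preservesOrder_or_reversesOrder
  · exact Or.inl (t.nonempty_iso_id ht)
  · obtain ⟨e⟩ := t.mirrorComp.nonempty_iso_id (t.preservesOrder_mirrorComp ht)
    obtain ⟨m⟩ := nonempty_mirrorFull_comp_mirrorFull 𝒬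
    -- If `F` followed by the mirror is the identity, then `F` is the mirror, because the mirror is
    -- an involution.
    exact Or.inr ⟨F.rightUnitor.symm ≪≫ Functor.isoWhiskerLeft F m.symm ≪≫
      (Functor.associator _ _ _).symm ≪≫ Functor.isoWhiskerRight e (mirrorFull 𝒬) ≪≫
      (mirrorFull 𝒬).leftUnitor⟩

end NSOperad

/-! ### Categorical description of the point, discrete operads and corollas -/

namespace NSOperad

section

variable {C : Type w} [Category.{v} C]

/-- A property that characterises the operad with a single colour and no operations but the
identity. -/
structure IsPoint (X : C) : Prop where
  eq_id (f : X ⟶ X) : f = 𝟙 X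
  exists_ne : ∃ (Z : C) (f g : X ⟶ Z), f ≠ g
  nonempty_hom {Y Z : C} (f g : Y ⟶ Z) (h : f ≠ g) : Nonempty (X ⟶ Y)

theorem IsPoint.map {X : C} (hX : IsPoint X) (e : C ≌ C) : IsPoint (e.functor.obj X) where
  eq_id f := by
    obtain ⟨f, rfl⟩ := e.functor.map_surjective f
    rw [hX.eq_id f, e.functor.map_id]
  exists_ne := by
    obtain ⟨Z, f, g, h⟩ := hX.exists_ne
    exact ⟨_, e.functor.map f, e.functor.map g, fun h' => h (e.functor.map_injective h')⟩
  nonempty_hom {Y Z} f g h := by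
    obtain ⟨k⟩ := hX.nonempty_hom (e.inverse.map f) (e.inverse.map g)
      fun h' => h (e.inverse.map_injective h')
    exact ⟨e.functor.map k ≫ e.counit.app Y⟩

end

variable {𝒬 : ObjectProperty NSOperad.{u}}

/-- An operad is discrete if it has no operations but the identities. -/
def IsDiscrete (X : 𝒬.FullSubcategory) : Prop := ∀ p : X.obj.Op, ∃ c, p = X.obj.one c

theorem IsDiscrete.of_iso {X Y : 𝒬.FullSubcategory} (hX : IsDiscrete X) (i : X ≅ Y) :
    IsDiscrete Y := fun p => by
  have := opMap_eq_one i.hom (hX (opMap i.inv p))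
  rwa [← opMap_comp, i.inv_hom_id, opMap_id] at this

/-- A morphism is inert if it sends all operations to identities. -/
def IsInert {X Y : 𝒬.FullSubcategory} (f : X ⟶ Y) : Prop :=
  ∀ p : X.obj.Op, ∃ c, opMap f p = Y.obj.one c

theorem IsInert.comp_left {X Y Z : 𝒬.FullSubcategory} {f : X ⟶ Y} (hf : IsInert f)
    (g : Y ⟶ Z) : IsInert (f ≫ g) := fun p => opMap_eq_one g (hf p)

theorem IsInert.comp_right {X Y Z : 𝒬.FullSubcategory} {g : Y ⟶ Z} (hg : IsInert g)
    (f : X ⟶ Y) : IsInert (f ≫ g) := fun p => hg (opMap f p)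

variable [Admissible 𝒬]

variable (𝒬) in
/-- The operad with a single colour and no operations but the identity. -/
abbrev point : 𝒬.FullSubcategory := disc 𝒬 PUnit

/-- The morphism from the point given by a colour. -/
def ofPoint {X : 𝒬.FullSubcategory} (c : X.obj.Col) : point 𝒬 ⟶ X := ofDisc fun _ => c

theorem isPoint_point : IsPoint (point 𝒬) where
  eq_id f := disc_hom_ext fun _ => rfl
  exists_ne := by
    refine ⟨cor 𝒬 1, ofPoint CorCol.root, ofPoint (CorCol.leaf 0), fun h => ?_⟩
    have h' : CorCol.root = CorCol.leaf (0 : Fin 1) := congrArg (fun f => colMap f PUnit.unit) h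
    simp at h'
  nonempty_hom {Y Z} f g h := by
    by_contra hY
    -- Without colours there are no operations either, since each has an output; parallel morphisms
    -- out of such an operad coincide.
    have hc : IsEmpty Y.obj.Col := ⟨fun c => hY ⟨ofPoint c⟩⟩
    exact h (full_hom_ext (fun c => hc.elim c) fun p => hc.elim (Y.obj.output p))

/-- Each of the two objects is the source of distinct parallel morphisms, so each maps to the other;
the composites are endomorphisms, hence identities. -/
theorem IsPoint.nonempty_iso {X : 𝒬.FullSubcategory} (hX : IsPoint X) :
    Nonempty (point 𝒬 ≅ X) := by
  obtain ⟨Z, f, g, h⟩ := isPoint_point (𝒬 := 𝒬).exists_ne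
  obtain ⟨k⟩ := hX.nonempty_hom f g h
  obtain ⟨Z, f, g, h⟩ := hX.exists_ne
  obtain ⟨k'⟩ := isPoint_point (𝒬 := 𝒬).nonempty_hom f g h
  exact ⟨⟨k', k, isPoint_point.eq_id _, hX.eq_id _⟩⟩

/-- Over a discrete operad any choice of preimages of colours is a section. Conversely, a section of
the discrete operad on the colours of `X` exhibits every operation of `X` as the image of an
identity. -/
theorem isDiscrete_iff (X : 𝒬.FullSubcategory) : IsDiscrete X ↔
    ∀ (Z : 𝒬.FullSubcategory) (g : Z ⟶ X), Function.Surjective (colMap g) →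
      ∃ s : X ⟶ Z, s ≫ g = 𝟙 X := by
  constructor
  · intro hX Z g hg
    choose k hk using hg
    let f : X.obj ⟶ Z.obj := homOfNontrivial k (fun p => Z.obj.one (k (X.obj.output p)))
      (fun p => by
        rw [Z.obj.inputs_one, X.obj.eq_of_one (hX p), X.obj.inputs_one, X.obj.output_one]
        rfl)
      (fun p => Z.obj.output_one _) (fun c => by rw [X.obj.output_one])
      (fun p _ _ _ hp => absurd (X.obj.eq_of_one (hX p)) (hp _))
    refine ⟨ObjectProperty.homMk f, full_hom_ext hk fun p => ?_⟩
    change opMap g (Z.obj.one (k (X.obj.output p))) = p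
    rw [opMap_one, hk, ← X.obj.eq_of_one (hX p)]
  · intro h p
    obtain ⟨s, hs⟩ := h (disc 𝒬 X.obj.Col) (ofDisc id) Function.surjective_id
    have := opMap_eq_one (ofDisc id) (disc_eq_one (opMap s p))
    rwa [← opMap_comp, hs, opMap_id] at this

/-- An inert morphism factors through the discrete operad on the colours of its target. This makes
inertness a categorical notion once discreteness is one. -/
theorem isInert_iff {X Y : 𝒬.FullSubcategory} (f : X ⟶ Y) : IsInert f ↔
    ∃ (D : 𝒬.FullSubcategory) (g : X ⟶ D) (h : D ⟶ Y), IsDiscrete D ∧ g ≫ h = f := by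
  constructor
  · intro hf
    let g : X.obj ⟶ (disc 𝒬 Y.obj.Col).obj :=
      homOfNontrivial (Q := (disc 𝒬 Y.obj.Col).obj) (@colMap 𝒬 X Y f)
        (fun p => (disc 𝒬 Y.obj.Col).obj.one (@colMap 𝒬 X Y f (X.obj.output p)))
      (fun p => by
        change [colMap f (X.obj.output p)] = List.map (colMap f) (X.obj.inputs p)
        rw [← output_opMap, ← inputs_opMap, Y.obj.eq_of_one (hf p), Y.obj.inputs_one,
          Y.obj.output_one])
      (fun p => rfl) (fun c => by rw [X.obj.output_one])
      (fun p qs h h' _ _ => by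
        refine ThinRel.op_ext (T := discRel _) ?_ ?_
        · refine Eq.trans ?_ (NSOperad.inputs_comp (disc 𝒬 Y.obj.Col).obj _ _ h').symm
          have hp := (inputs_opMap f p).symm
          rw [Y.obj.eq_of_one (hf p), Y.obj.inputs_one, ← h, List.map_map,
            List.map_eq_singleton_iff] at hp
          obtain ⟨q, rfl, hq⟩ := hp
          refine Eq.trans ?_ (List.append_nil _).symm
          change [colMap f (X.obj.output (X.obj.comp p [q] h))] = [colMap f (X.obj.output q)]
          rw [X.obj.output_comp]
          rw [output_opMap] at hq
          exact congrArg (fun c => [c]) hq.symm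
        · change colMap f (X.obj.output (X.obj.comp p qs h)) = colMap f (X.obj.output p)
          rw [X.obj.output_comp])
    refine ⟨disc 𝒬 Y.obj.Col, ObjectProperty.homMk g, ofDisc id, disc_eq_one,
      full_hom_ext (fun _ => rfl) fun p => ?_⟩
    change Y.obj.one (colMap f (X.obj.output p)) = opMap f p
    rw [← output_opMap, ← Y.obj.eq_of_one (hf p)]
  · rintro ⟨D, g, h, hD, rfl⟩ p
    exact opMap_eq_one h (hD _)

/-- Morphisms from the point correspond to colours. -/
def pointEquiv (X : 𝒬.FullSubcategory) : (point 𝒬 ⟶ X) ≃ X.obj.Col where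
  toFun f := colMap f PUnit.unit
  invFun c := ofPoint c
  left_inv _ := disc_hom_ext fun _ => rfl
  right_inv _ := rfl

/-- Morphisms from corollas correspond to operations. -/
noncomputable def corEquiv (X : 𝒬.FullSubcategory) : (Σ n, cor 𝒬 n ⟶ X) ≃ X.obj.Op where
  toFun f := opMap f.2 (top _)
  invFun p := ⟨_, ofCor X p rfl⟩
  left_inv := by
    rintro ⟨n, f⟩
    have h : (X.obj.inputs (opMap f (top n))).length = n := by
      rw [length_inputs_opMap, length_inputs_top]
    obtain ⟨q, hq⟩ : ∃ q, opMap f (top n) = q := ⟨_, rfl⟩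
    change (⟨_, ofCor X (opMap f (top n)) rfl⟩ : Σ n, cor 𝒬 n ⟶ X) = ⟨n, f⟩
    rw [hq] at h ⊢
    subst h
    exact congrArg (Sigma.mk _) (cor_hom_ext ((opMap_ofCor X q rfl).trans hq.symm))
  right_inv p := opMap_ofCor X p rfl

theorem isDiscrete_point : IsDiscrete (point 𝒬) := disc_eq_one

theorem not_isDiscrete_cor (n : ℕ) : ¬ IsDiscrete (cor 𝒬 n) := fun h => by
  obtain ⟨c, hc⟩ := h (top n)
  exact corTop_ne_one n c hc

theorem cor_cases {n : ℕ} (p : (cor 𝒬 n).obj.Op) :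
    (∃ c, p = (cor 𝒬 n).obj.one c) ∨ p = top n := corRel_cases p

/-- A morphism to a corolla that is not inert is split. -/
theorem exists_section {n : ℕ} {Y : 𝒬.FullSubcategory} (f : Y ⟶ cor 𝒬 n) (hf : ¬ IsInert f) :
    ∃ s, s ≫ f = 𝟙 _ := by
  rw [IsInert, not_forall] at hf
  obtain ⟨q, hq⟩ := hf
  have hq' := (cor_cases (opMap f q)).resolve_left hq
  have h : (Y.obj.inputs q).length = n := by
    rw [← length_inputs_opMap f, hq', length_inputs_top]
  refine ⟨ofCor Y q h, cor_hom_ext ?_⟩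
  rw [opMap_comp, opMap_ofCor, hq']
  rfl

/-- An endomorphism of a corolla that is not inert is the identity. -/
theorem eq_id_of_not_isInert {n : ℕ} (f : cor 𝒬 n ⟶ cor 𝒬 n) (hf : ¬ IsInert f) : f = 𝟙 _ := by
  refine cor_hom_ext ((cor_cases _).resolve_left fun h => hf fun p => ?_)
  obtain hp | rfl := cor_cases p
  · exact opMap_eq_one f hp
  · exact h

variable (e : 𝒬.FullSubcategory ≌ 𝒬.FullSubcategory)

/-- An equivalence preserves the point. -/
noncomputable def pointIso : point 𝒬 ≅ e.functor.obj (point 𝒬) :=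
  (isPoint_point.map e).nonempty_iso.some

/-- The bijection on colours induced by an equivalence. -/
noncomputable def colEquiv (X : 𝒬.FullSubcategory) : X.obj.Col ≃ (e.functor.obj X).obj.Col :=
  (pointEquiv X).symm.trans <| e.fullyFaithfulFunctor.homEquiv.trans <|
    ((pointIso e).homFromEquiv).symm.trans (pointEquiv _)

theorem colEquiv_apply (X : 𝒬.FullSubcategory) (c : X.obj.Col) :
    colEquiv e X c = colMap ((pointIso e).hom ≫ e.functor.map (ofPoint c)) PUnit.unit := rfl

theorem colMap_colEquiv {X Y : 𝒬.FullSubcategory} (f : X ⟶ Y) (c : X.obj.Col) :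
    colMap (e.functor.map f) (colEquiv e X c) = colEquiv e Y (colMap f c) := by
  have h : ofPoint c ≫ f = ofPoint (colMap f c) := disc_hom_ext fun _ => rfl
  rw [colEquiv_apply, colEquiv_apply, ← h, e.functor.map_comp, ← Category.assoc]
  rfl

theorem surjective_colMap_map {X Y : 𝒬.FullSubcategory} (f : X ⟶ Y)
    (hf : Function.Surjective (colMap f)) : Function.Surjective (colMap (e.functor.map f)) := by
  intro d
  obtain ⟨d, rfl⟩ := (colEquiv e Y).surjective d
  obtain ⟨c, rfl⟩ := hf d
  exact ⟨_, colMap_colEquiv e f c⟩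

/-- Surjectivity on colours is preserved by equivalences, as colours are morphisms from the point;
so the lifting criterion `isDiscrete_iff` can be transported through the inverse equivalence. -/
theorem IsDiscrete.map {X : 𝒬.FullSubcategory} (hX : IsDiscrete X) :
    IsDiscrete (e.functor.obj X) := by
  rw [isDiscrete_iff]
  intro Z g hg
  have hg' : Function.Surjective (colMap (e.inverse.map g ≫ e.unitInv.app X)) := by
    intro c
    have h₁ : Function.Surjective (colMap (e.inverse.map g)) := surjective_colMap_map e.symm g hg
    obtain ⟨d, hd⟩ := h₁ (colMap (e.unit.app X) c)
    refine ⟨d, ?_⟩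
    rw [colMap_comp, hd, ← colMap_comp]
    simp only [Functor.id_obj, Equivalence.unit, Equivalence.unitInv,
      Iso.hom_inv_id_app]
    rfl
  obtain ⟨s, hs⟩ := (isDiscrete_iff X).1 hX _ _ hg'
  refine ⟨e.functor.map s ≫ e.counit.app Z, ?_⟩
  have := congrArg e.functor.map hs
  simpa using this

theorem IsInert.map {X Y : 𝒬.FullSubcategory} {f : X ⟶ Y} (hf : IsInert f) :
    IsInert (e.functor.map f) := by
  rw [isInert_iff] at hf ⊢
  obtain ⟨D, g, h, hD, rfl⟩ := hf
  exact ⟨_, _, _, hD.map e, (e.functor.map_comp g h).symm⟩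

theorem nat_card_corCol (n : ℕ) : Nat.card (CorCol.{u} n) = n + 1 := by
  let i : CorCol.{u} n ≃ Option (Fin n) :=
    { toFun := fun | .root => none | .leaf j => some j
      invFun := fun | none => .root | some j => .leaf j
      left_inv := by rintro (_ | _) <;> rfl
      right_inv := by rintro (_ | _) <;> rfl }
  simp [Nat.card_congr i]

/-- A non-identity operation of the image classifies a non-inert morphism `f` from some corolla.
Transported back, `f` becomes a non-inert morphism to a corolla and so has a section. The other
composite is a non-inert endomorphism of a corolla, hence the identity. -/
theorem nonempty_corIso (n : ℕ) : Nonempty (cor 𝒬 n ≅ e.functor.obj (cor 𝒬 n)) := by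
  have hX : ¬ IsDiscrete (e.functor.obj (cor 𝒬 n)) := fun h =>
    not_isDiscrete_cor n ((h.map e.symm).of_iso (e.unitIso.symm.app (cor 𝒬 n)))
  rw [IsDiscrete, not_forall] at hX
  obtain ⟨p, hp⟩ := hX
  let f := ofCor (e.functor.obj (cor 𝒬 n)) p rfl
  have hf : ¬ IsInert f := fun h => hp (by
    have := h (top _)
    rwa [opMap_ofCor] at this)
  have hf' : ¬ IsInert (e.inverse.map f ≫ e.unitInv.app (cor 𝒬 n)) := fun h => hf (by
    have := (h.map e).comp_right (e.counitInv.app _)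
    simpa using this)
  obtain ⟨s, hs⟩ := exists_section _ hf'
  let s' := e.functor.map s ≫ e.counit.app _
  have hs' : s' ≫ f = 𝟙 _ := by
    have := congrArg e.functor.map hs
    simpa [s'] using this
  have hfs : f ≫ s' = 𝟙 _ := by
    refine eq_id_of_not_isInert _ fun h => hf ?_
    have := h.comp_left f
    rwa [Category.assoc, hs', Category.comp_id] at this
  let i : cor 𝒬 ((e.functor.obj (cor 𝒬 n)).obj.inputs p).length ≅ e.functor.obj (cor 𝒬 n) :=
    ⟨f, s', hfs, hs'⟩
  -- The arity is recovered by counting colours, which are preserved: a corolla with `n` inputs has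
  -- `n + 1` of them.
  have hcard : ((e.functor.obj (cor 𝒬 n)).obj.inputs p).length = n := by
    have h₁ : Nat.card (e.functor.obj (cor 𝒬 n)).obj.Col = n + 1 :=
      (Nat.card_congr (colEquiv e (cor 𝒬 n))).symm.trans (nat_card_corCol n)
    have h₂ : Nat.card (e.functor.obj (cor 𝒬 n)).obj.Col =
        ((e.functor.obj (cor 𝒬 n)).obj.inputs p).length + 1 := by
      refine Eq.trans (Nat.card_congr ?_).symm (nat_card_corCol _)
      refine ⟨colMap i.hom, colMap i.inv, fun c => ?_, fun c => ?_⟩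
      · exact (colMap_comp i.hom i.inv c).symm.trans (congrArg (fun g => colMap g c) i.hom_inv_id)
      · exact (colMap_comp i.inv i.hom c).symm.trans (congrArg (fun g => colMap g c) i.inv_hom_id)
    omega
  rw [hcard] at i
  exact ⟨i⟩

/-- An equivalence preserves corollas. -/
noncomputable def corIso (n : ℕ) : cor 𝒬 n ≅ e.functor.obj (cor 𝒬 n) :=
  (nonempty_corIso e n).some

/-- The bijection on operations induced by an equivalence. -/
noncomputable def opEquiv (X : 𝒬.FullSubcategory) : X.obj.Op ≃ (e.functor.obj X).obj.Op :=
  (corEquiv X).symm.trans <| (Equiv.sigmaCongrRight fun n =>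
    e.fullyFaithfulFunctor.homEquiv.trans ((corIso e n).homFromEquiv).symm).trans (corEquiv _)

theorem opEquiv_apply (X : 𝒬.FullSubcategory) (p : X.obj.Op) {n : ℕ}
    (h : (X.obj.inputs p).length = n) :
    opEquiv e X p = opMap ((corIso e n).hom ≫ e.functor.map (ofCor X p h)) (top n) := by
  subst h
  rfl

theorem opMap_opEquiv {X Y : 𝒬.FullSubcategory} (f : X ⟶ Y) (p : X.obj.Op) :
    opMap (e.functor.map f) (opEquiv e X p) = opEquiv e Y (opMap f p) := by
  have h : ofCor X p rfl ≫ f = ofCor Y (opMap f p) (length_inputs_opMap f p) := by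
    refine cor_hom_ext ?_
    rw [opMap_comp, opMap_ofCor, opMap_ofCor]
  rw [opEquiv_apply e X p rfl, opEquiv_apply e Y _ (length_inputs_opMap f p), ← opMap_comp, ← h,
    e.functor.map_comp, Category.assoc]

/-- The bijections on colours and operations induced by an equivalence. -/
noncomputable def transferOfEquivalence : Transfer e.functor where
  col := colEquiv e
  op := opEquiv e
  col_map := colMap_colEquiv e
  op_map := opMap_opEquiv e
  length_inputs X p := by
    rw [opEquiv_apply e X p rfl, length_inputs_opMap, length_inputs_top]
  op_one X c := by
    -- Identities are the images of the operation of the point, and the image of the point under the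
    -- equivalence is discrete.
    have h : opMap (ofPoint c) ((point 𝒬).obj.one PUnit.unit) = X.obj.one c := opMap_one _ _
    rw [← h, ← opMap_opEquiv]
    exact opMap_eq_one _ (isDiscrete_point.map e _)
  nodup_top n := by
    have h : ofCor (cor 𝒬 n) (top n) (length_inputs_top n) = 𝟙 _ := by
      refine cor_hom_ext ?_
      rw [opMap_ofCor, opMap_id]
    have hinj : Function.Injective (colMap (corIso e n).hom) :=
      Function.LeftInverse.injective (g := colMap (corIso e n).inv) fun c => by
        rw [← colMap_comp, (corIso e n).hom_inv_id, colMap_id]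
    rw [opEquiv_apply e _ _ (length_inputs_top n), h, e.functor.map_id, Category.comp_id,
      output_opMap, inputs_opMap]
    refine List.Nodup.map (l := CorCol.root :: corLeaves n) hinj ?_
    refine List.nodup_cons.2 ⟨root_notMem_corLeaves n, (List.nodup_finRange n).map ?_⟩
    intro i j hij
    simpa using hij

theorem nonempty_iso_of_isEquivalence (F : 𝒬.FullSubcategory ⥤ 𝒬.FullSubcategory)
    [F.IsEquivalence] : Nonempty (F ≅ 𝟭 _) ∨ Nonempty (F ≅ mirrorFull 𝒬) :=
  (transferOfEquivalence F.asEquivalence).nonempty_iso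

end NSOperad

/-! ### The monoidal category of autoequivalences -/

section

variable {C : Type w} [Category.{v} C]

attribute [local instance] endofunctorMonoidalCategory

open MonoidalCategory

/-- If every autoequivalence of a category is isomorphic to the identity or to an involution `M`,
and there are no non-trivial natural transformations between these, then the category of
autoequivalences is monoidally equivalent to the group with two elements. -/
theorem exists_monoidal_equivalence (M : C ⥤ C) [M.IsEquivalence] (hM : Nonempty (M ⋙ M ≅ 𝟭 C))
    (hF : ∀ F : C ⥤ C, F.IsEquivalence → Nonempty (F ≅ 𝟭 C) ∨ Nonempty (F ≅ M))
    (hid : ∀ α : 𝟭 C ⟶ 𝟭 C, α = 𝟙 _) (hidM : IsEmpty (𝟭 C ⟶ M)) :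
    ∃ E : Discrete (Multiplicative (ZMod 2)) ⥤ AutoEquivCat C,
      Nonempty E.Monoidal ∧ E.IsEquivalence ∧ (E.obj ⟨Multiplicative.ofAdd 0⟩).obj = 𝟭 C ∧
        (E.obj ⟨Multiplicative.ofAdd 1⟩).obj = M := by
  obtain ⟨m⟩ := hM
  -- Whiskering with the involution exchanges the identity and `M`.
  have hMid : IsEmpty (M ⟶ 𝟭 C) :=
    ⟨fun α => hidM.false (m.inv ≫ Functor.whiskerRight α M ≫ M.leftUnitor.hom)⟩
  have hMM (α : M ⟶ M) : α = 𝟙 _ := by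
    have h := hid (m.inv ≫ Functor.whiskerRight α M ≫ m.hom)
    rw [← Category.assoc, Iso.comp_hom_eq_id] at h
    replace h : Functor.whiskerRight α M = 𝟙 _ := by
      rw [← cancel_epi m.inv, h, Category.comp_id]
    ext X
    refine M.map_injective ?_
    exact (NatTrans.congr_app h X).trans (M.map_id _).symm
  let I : AutoEquivCat C := ⟨𝟭 C, inferInstanceAs (𝟭 C).IsEquivalence⟩
  let J : AutoEquivCat C := ⟨M, inferInstanceAs M.IsEquivalence⟩
  have hcases (A : AutoEquivCat C) : Nonempty (A ≅ I) ∨ Nonempty (A ≅ J) :=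
    (hF A.obj A.property).imp (fun ⟨i⟩ => ⟨ObjectProperty.isoMk _ i⟩)
      fun ⟨i⟩ => ⟨ObjectProperty.isoMk _ i⟩
  have key {A A' B B' : AutoEquivCat C} (i : A ≅ A') (j : B ≅ B')
      (h : ∀ f g : A' ⟶ B', f = g) (f g : A ⟶ B) : f = g := by
    have := h (i.inv ≫ f ≫ j.hom) (i.inv ≫ g ≫ j.hom)
    simpa using this
  have hII (f g : I ⟶ I) : f = g :=
    ObjectProperty.hom_ext _ ((hid f.hom).trans (hid g.hom).symm)
  have hJJ (f g : J ⟶ J) : f = g :=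
    ObjectProperty.hom_ext _ ((hMM f.hom).trans (hMM g.hom).symm)
  -- Parallel morphisms agree, so the monoidal structure below can be built from arbitrarily chosen
  -- isomorphisms, all coherence conditions being automatic.
  have hthin (A B : AutoEquivCat C) (f g : A ⟶ B) : f = g := by
    have hIJ (f g : I ⟶ J) : f = g := (hidM.false f.hom).elim
    have hJI (f g : J ⟶ I) : f = g := (hMid.false f.hom).elim
    obtain i | i := hcases A <;> obtain j | j := hcases B
    · exact key i.some j.some hII f g
    · exact key i.some j.some hIJ f g
    · exact key i.some j.some hJI f g
    · exact key i.some j.some hJJ f g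
  let E : Discrete (Multiplicative (ZMod 2)) ⥤ AutoEquivCat C :=
    -- In multiplicative notation `1` is the neutral element, that is, the class of 0; the values
    -- are the identity and `M` themselves, not merely isomorphic functors.
    Discrete.functor fun a => if a = 1 then I else J
  have hE₁ (a : Discrete (Multiplicative (ZMod 2))) (h : a.as = 1) : E.obj a = I := if_pos h
  have hE₂ (a : Discrete (Multiplicative (ZMod 2))) (h : a.as ≠ 1) : E.obj a = J := if_neg h
  have hmul : ∀ a b : Multiplicative (ZMod 2), a ≠ 1 → b ≠ 1 → a * b = 1 := by decide
  have hμ (a b : Discrete (Multiplicative (ZMod 2))) :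
      Nonempty (E.obj a ⊗ E.obj b ≅ E.obj (a ⊗ b)) := by
    have hab : (a ⊗ b).as = a.as * b.as := rfl
    by_cases ha : a.as = 1 <;> by_cases hb : b.as = 1
    · rw [hE₁ a ha, hE₁ b hb, hE₁ _ (by rw [hab, ha, hb, mul_one])]
      exact ⟨ObjectProperty.isoMk _ (Functor.leftUnitor (𝟭 C))⟩
    · rw [hE₁ a ha, hE₂ b hb, hE₂ _ (by rwa [hab, ha, one_mul])]
      exact ⟨ObjectProperty.isoMk _ (Functor.leftUnitor M)⟩
    · rw [hE₂ a ha, hE₁ b hb, hE₂ _ (by rwa [hab, hb, mul_one])]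
      exact ⟨ObjectProperty.isoMk _ (Functor.rightUnitor M)⟩
    · rw [hE₂ a ha, hE₂ b hb, hE₁ _ (by rw [hab, hmul _ _ ha hb])]
      exact ⟨ObjectProperty.isoMk _ m⟩
  have hε : Nonempty (𝟙_ (AutoEquivCat C) ≅ E.obj (𝟙_ _)) := by
    rw [hE₁ (𝟙_ _) rfl]
    exact ⟨Iso.refl _⟩
  let mon : E.CoreMonoidal :=
    { εIso := hε.some
      μIso := fun a b => (hμ a b).some
      μIso_hom_natural_left := fun _ _ => hthin _ _ _ _
      μIso_hom_natural_right := fun _ _ => hthin _ _ _ _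
      associativity := fun _ _ _ => hthin _ _ _ _
      left_unitality := fun _ => hthin _ _ _ _
      right_unitality := fun _ => hthin _ _ _ _ }
  have hfaithful : E.Faithful := ⟨fun _ => Subsingleton.elim _ _⟩
  have hfull : E.Full := ⟨fun {a b} f => by
    suffices h : a = b by
      subst h
      exact ⟨𝟙 _, hthin _ _ _ _⟩
    have heq : ∀ x y : Multiplicative (ZMod 2), x ≠ 1 → y ≠ 1 → x = y := by decide
    by_cases ha : a.as = 1 <;> by_cases hb : b.as = 1
    · exact Discrete.ext (ha.trans hb.symm)
    · rw [hE₁ a ha, hE₂ b hb] at f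
      exact (hidM.false f.hom).elim
    · rw [hE₂ a ha, hE₁ b hb] at f
      exact (hMid.false f.hom).elim
    · exact Discrete.ext (heq _ _ ha hb)⟩
  have hsurj : E.EssSurj := ⟨fun A => by
    obtain i | i := hcases A
    · exact ⟨⟨1⟩, ⟨eqToIso (hE₁ _ rfl) ≪≫ i.some.symm⟩⟩
    · exact ⟨⟨Multiplicative.ofAdd 1⟩, ⟨eqToIso (hE₂ _ (by decide)) ≪≫ i.some.symm⟩⟩⟩
  refine ⟨E, ⟨mon.toMonoidal⟩, { }, ?_, ?_⟩
  · exact congrArg ObjectProperty.FullSubcategory.obj (hE₁ _ rfl)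
  · exact congrArg ObjectProperty.FullSubcategory.obj (hE₂ _ (by decide))

end

/-! ### Conclusion for all operads and for rigid operads -/

namespace NSOperad

theorem isEquivalence_of_involution {C : Type w} [Category.{v} C] {M : C ⥤ C}
    (h : Nonempty (M ⋙ M ≅ 𝟭 C)) : M.IsEquivalence :=
  (CategoryTheory.Equivalence.mk M M h.some.symm h.some).isEquivalence_functor

/-- The functor from operads to the full subcategory of all operads. -/
def toTop : NSOperad.{u} ⥤ (⊤ : ObjectProperty NSOperad.{u}).FullSubcategory :=
  ObjectProperty.lift _ (𝟭 _) fun _ => trivial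

theorem toTop_isEquivalence : toTop.{u}.IsEquivalence :=
  (CategoryTheory.Equivalence.mk toTop (ObjectProperty.ι ⊤) (Iso.refl _)
    (Iso.refl _)).isEquivalence_functor

theorem ι_top_isEquivalence : (ObjectProperty.ι (⊤ : ObjectProperty NSOperad.{u})).IsEquivalence :=
  (CategoryTheory.Equivalence.mk toTop (ObjectProperty.ι ⊤) (Iso.refl _)
    (Iso.refl _)).isEquivalence_inverse

end NSOperad

open NSOperad in
theorem mainTheorem9 :
    (∃ E : Discrete (Multiplicative (ZMod 2)) ⥤ AutoEquivCat NSOperad.{u},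
      Nonempty E.Monoidal ∧ E.IsEquivalence ∧
        (E.obj ⟨Multiplicative.ofAdd 0⟩).obj = 𝟭 NSOperad.{u} ∧
        (E.obj ⟨Multiplicative.ofAdd 1⟩).obj = NSOperad.mirror.{u}) ∧
    (∃ E : Discrete (Multiplicative (ZMod 2)) ⥤ AutoEquivCat NSOperad.RigidCat.{u},
      Nonempty E.Monoidal ∧ E.IsEquivalence ∧
        (E.obj ⟨Multiplicative.ofAdd 0⟩).obj = 𝟭 NSOperad.RigidCat.{u} ∧
        (E.obj ⟨Multiplicative.ofAdd 1⟩).obj = NSOperad.rigidMirror.{u}) := by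
  constructor
  · have hM : Nonempty (mirror.{u} ⋙ mirror ≅ 𝟭 _) := by
      obtain ⟨m⟩ := nonempty_mirrorFull_comp_mirrorFull (⊤ : ObjectProperty NSOperad.{u})
      exact ⟨Functor.isoWhiskerLeft toTop (Functor.isoWhiskerRight m (ObjectProperty.ι ⊤))⟩
    have := isEquivalence_of_involution hM
    have h₁ := toTop_isEquivalence.{u}
    have h₂ := ι_top_isEquivalence.{u}
    refine exists_monoidal_equivalence mirror hM (fun F hF => ?_) (fun α => ?_) ⟨fun α => ?_⟩
    · have : (ObjectProperty.ι ⊤ ⋙ F ⋙ toTop).IsEquivalence := inferInstance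
      refine (nonempty_iso_of_isEquivalence (ObjectProperty.ι ⊤ ⋙ F ⋙ toTop)).imp ?_ ?_
      · rintro ⟨i⟩
        exact ⟨Functor.isoWhiskerLeft toTop (Functor.isoWhiskerRight i (ObjectProperty.ι ⊤))⟩
      · rintro ⟨i⟩
        exact ⟨Functor.isoWhiskerLeft toTop (Functor.isoWhiskerRight i (ObjectProperty.ι ⊤))⟩
    · let β : 𝟭 (⊤ : ObjectProperty NSOperad.{u}).FullSubcategory ⟶ 𝟭 _ :=
        { app := fun X => ObjectProperty.homMk (α.app X.obj)
          naturality := fun X Y f => ObjectProperty.hom_ext _ (α.naturality f.hom) }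
      ext X : 2
      exact congrArg (fun γ => (γ.app (toTop.obj X)).hom) (natTrans_id_id β)
    · exact (isEmpty_natTrans_id_mirror (𝒬 := ⊤)).false
        { app := fun X => ObjectProperty.homMk (α.app X.obj)
          naturality := fun X Y f => ObjectProperty.hom_ext _ (α.naturality f.hom) }
  · have hM : Nonempty (rigidMirror.{u} ⋙ rigidMirror ≅ 𝟭 _) :=
      nonempty_mirrorFull_comp_mirrorFull Rigid
    have := isEquivalence_of_involution hM
    exact exists_monoidal_equivalence rigidMirror hM
      (fun F hF => nonempty_iso_of_isEquivalence F) natTrans_id_id isEmpty_natTrans_id_mirror
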